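/- Let $\Gamma$ be a metric graph, that is, a finite graph (loops and multiple edges allowed) each of whose edges is identified with a real interval of finite positive length. $\mathrm{PL}(\Gamma)$ is the set of continuous piecewise linear functions on $\Gamma$ with integer slopes, $T_v(\Gamma)$ the set of outgoing tangent vectors at $v$, and $\mathrm{val}(v)=|T_v(\Gamma)|$. For $f\in\mathrm{PL}(\Gamma)$ let $\mathrm{sl}_\eta(f)$ be its outgoing slope along $\eta$, $\mathrm{ord}_v(f)=-\sum_{\eta\in T_v(\Gamma)}\mathrm{sl}_\eta(f)$ and $\mathrm{div}(f)=\sum_v\mathrm{ord}_v(f)\,v$. For a divisor $D$ let $R(D)=\{f\in\mathrm{PL}(\Gamma):\mathrm{div}(f)+D\ge 0\}$. Functions $f_1,\dots,f_n$ are tropically dependent if for some $a_i\in\mathbb R$ the minimum of the $f_i+a_i$ is attained at least twice at every point. A tropical submodule is a set of functions closed under tropical linear combinations $\min_i(f_i+a_i)$. A tropical linear series of rank $r\ge 0$ is a pair $(D,\Sigma)$, where $\Sigma\subseteq R(D)$ is a finitely generated tropical submodule, such that (1) for each effective divisor $E$ of degree $r$ some $f\in\Sigma$ has $\mathrm{div}(f)+D\ge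 E$, and (2) every set of $r+2$ functions in $\Sigma$ is tropically dependent. It is strongly recursive if, recursively, (3) for $r\ge1$ every set of $r$ functions in $\Sigma$ is contained in a strongly recursive tropical linear subseries $\Sigma'\subseteq\Sigma$ of rank $r-1$, and (4) for all $S_1,S_2\subseteq\Sigma$ of sizes $s_1,s_2\le r$ with $s_1+s_2\ge r+2$ there are strongly recursive tropical linear subseries $\Sigma_1\supseteq S_1$, $\Sigma_2\supseteq S_2$ of $\Sigma$, of ranks $s_1-1$ and $s_2-1$, such that $\Sigma_1\cap\Sigma_2$ contains a strongly recursive tropical linear series of rank $s_1+s_2-r-2$. A dot array is a subset $P\subseteq\{0,\dots,r\}^d$ (with the componentwise order). It has rank $s$ if for each $i$ the $i$-th coordinate takes exactly $s+1$ values on $P$. It is totally rankable if $P[\mathbf x]=\{\mathbf y\in P:\mathbf y\succeq\mathbf x\}$ has a rank for each $\mathbf x\in\{0,\dots,r\}^d$, and then its rank array is $\rho_P(\mathbf x)=\operatorname{rank}P[\mathbf x]$. A position $\mathbf x$ is redundant if it is the meet of at least two elements of $P$, each having a coordinate in common with $\mathbf x$. A permutation array of rank $r$ is a totally rankable $P\subseteq\{0,\dots,r\}^d$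 of rank $r$ none of whose elements is redundant; its redundant closure $\overline P$ is the union of $P$ and the set of its redundant positions. An $r$-slope structure $\mathfrak S$ on $\Gamma$ consists of a finite set $V\subset\Gamma$ containing all points of valence $\ne 2$; integers $s^\eta_0<\dots<s^\eta_r$ for each tangent vector $\eta$; and for each $v\in\Gamma$ a permutation array $P_v$ of rank $r$ and dimension $\mathrm{val}(v)$, with axes indexed by $T_v(\Gamma)$. It is required that on each connected component of $\Gamma\setminus V$ the $s^\eta_i$ are the same for all tangent vectors $\eta$ along the component (including those at its end points that point into it) in the same direction, and $s^\eta_i+s^\xi_{r-i}=0$ if $\xi$ points in the opposite direction; and that $P_v=\{\mathbf x:\sum_i x_i=r\}$ for $v\notin V$. A function $f\in\mathrm{PL}(\Gamma)$ is compatible with $\mathfrak S$ if for each $v$ there is $\partial_v(f)\in\overline{P_v}$ such that $\mathrm{sl}_\eta(f)=s^\eta_{\partial_v(f)_\eta}$ for all $\eta\in T_v(\Gamma)$. Then its rank at $v$ is $\rho_v(f)=\rho_{P_v}(\partial_v(f))$. Let $R(D,\mathfrak S)$ be the set of $f\in R(D)$ compatible with $\mathfrak S$. At an isolated point $v$, where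 there are no axes, every inequality $\rho_v(f)\ge n$ is regarded as true. **Theorem.** Let $(D,\Sigma)$ be a strongly recursive tropical linear series of rank $r$ on $\Gamma$. Then there is an $r$-slope structure $\mathfrak S$ with $\Sigma\subseteq R(D,\mathfrak S)$. Moreover, for every such $\mathfrak S$, every effective divisor $E$ with $\deg E\le r$ and every $f\in\Sigma$: if $f$ satisfies the local rank property for $E$, i.e. $\rho_v(f)\ge E(v)$ for all $v\in\Gamma$, then $f$ satisfies the Baker–Norine rank property for $E$, i.e. $\mathrm{div}(f)+D\ge E$. -/

import Mathlib

/-- A metric graph presented by a finite multigraph (loops and multiple edges are allowed), with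
vertices `V` and edges `E`: the edge `e` is a real interval `[0, len e]`, glued at `0` to `src e`
and at `len e` to `tgt e`. -/
structure MetricGraph (V E : Type*) where
  src : E → V
  tgt : E → V
  len : E → ℝ
  len_pos : ∀ e, 0 < len e

namespace MetricGraph

/-- The points of a metric graph: its vertices and the interior points of its edges. -/
inductive Point {V E : Type*} (Γ : MetricGraph V E)
  | vertex (v : V) : Point Γ
  | interior (e : E) (t : ℝ) (ht : t ∈ Set.Ioo 0 (Γ.len e)) : Point Γ

open Classical in
/-- The parametrisation of the closed edge `e` by `[0, len e]` (constant outside of it). -/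
noncomputable def pt {V E : Type*} (Γ : MetricGraph V E) (e : E) (t : ℝ) : Γ.Point :=
  if h : t ∈ Set.Ioo 0 (Γ.len e) then .interior e t h
  else if t ≤ 0 then .vertex (Γ.src e) else .vertex (Γ.tgt e)

/-- `(e, true)` is the direction of increasing parameter along `e`, and `(e, false)` the opposite
one. At a vertex, only the directions that lead into an edge count; a loop gives two of them. -/
def Emanates {V E : Type*} (Γ : MetricGraph V E) : Γ.Point → E × Bool → Prop
  | .vertex v, (e, true) => Γ.src e = v
  | .vertex v, (e, false) => Γ.tgt e = v
  | .interior e' _ _, (e, _) => e' = e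

/-- The set `T_x(Γ)` of outgoing tangent vectors at `x`. -/
def Tangent {V E : Type*} (Γ : MetricGraph V E) (x : Γ.Point) : Type _ :=
  {η : E × Bool // Γ.Emanates x η}

noncomputable instance {V E : Type*} [Fintype E] (Γ : MetricGraph V E) (x : Γ.Point) :
    Fintype (Γ.Tangent x) :=
  @Fintype.ofFinite _ (inferInstanceAs (Finite {η : E × Bool // Γ.Emanates x η}))

/-- The valence of a point. -/
noncomputable def valence {V E : Type*} [Fintype E] (Γ : MetricGraph V E) (x : Γ.Point) : ℕ :=
  Fintype.card (Γ.Tangent x)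

/-- The parameter of `x` on the edge along which `η` points. -/
noncomputable def coord {V E : Type*} (Γ : MetricGraph V E) :
    (x : Γ.Point) → Γ.Tangent x → ℝ
  | .vertex _, η => if η.1.2 then 0 else Γ.len η.1.1
  | .interior _ t _, _ => t

/-- The unit speed path that starts at `x` in the direction `η`. -/
noncomputable def path {V E : Type*} (Γ : MetricGraph V E) (x : Γ.Point) (η : Γ.Tangent x)
    (t : ℝ) : Γ.Point :=
  Γ.pt η.1.1 (if η.1.2 then Γ.coord x η + t else Γ.coord x η - t)

/-- `PL(Γ)`: on each closed edge there is a finite subdivision such that `f` is affine with integer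
slope on each closed piece (in particular, `f` is continuous). -/
def IsPL {V E : Type*} (Γ : MetricGraph V E) (f : Γ.Point → ℝ) : Prop :=
  ∀ e, ∃ (n : ℕ) (p : ℕ → ℝ), Monotone p ∧ p 0 = 0 ∧ p n = Γ.len e ∧
    ∀ i < n, ∃ m : ℤ, ∀ t ∈ Set.Icc (p i) (p (i + 1)),
      f (Γ.pt e t) = f (Γ.pt e (p i)) + m * (t - p i)

/-- `f` is affine with slope `m` near `x` along `η`. -/
def HasSlope {V E : Type*} (Γ : MetricGraph V E) (f : Γ.Point → ℝ) (x : Γ.Point)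
    (η : Γ.Tangent x) (m : ℤ) : Prop :=
  ∃ ε > 0, ∀ t ∈ Set.Icc 0 ε, f (Γ.path x η t) = f x + m * t

theorem HasSlope.unique {V E : Type*} {Γ : MetricGraph V E} {f : Γ.Point → ℝ} {x : Γ.Point}
    {η : Γ.Tangent x} {m n : ℤ} (hm : Γ.HasSlope f x η m) (hn : Γ.HasSlope f x η n) : m = n := by
  obtain ⟨ε, hε, h1⟩ := hm
  obtain ⟨δ, hδ, h2⟩ := hn
  have hpos : 0 < min ε δ := lt_min hε hδ
  have e1 := h1 (min ε δ) ⟨hpos.le, min_le_left _ _⟩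
  have e2 := h2 (min ε δ) ⟨hpos.le, min_le_right _ _⟩
  have h3 : (m : ℝ) * min ε δ = n * min ε δ := by linarith
  exact_mod_cast mul_right_cancel₀ hpos.ne' h3

open Classical in
/-- The outgoing slope `sl_η(f)` (the value `0` is a default that does not occur for `f` in
`PL(Γ)`). -/
noncomputable def slope {V E : Type*} (Γ : MetricGraph V E) (f : Γ.Point → ℝ) (x : Γ.Point)
    (η : Γ.Tangent x) : ℤ :=
  if h : ∃ m, Γ.HasSlope f x η m then h.choose else 0

theorem HasSlope.slope_eq {V E : Type*} {Γ : MetricGraph V E} {f : Γ.Point → ℝ} {x : Γ.Point}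
    {η : Γ.Tangent x} {m : ℤ} (hm : Γ.HasSlope f x η m) : Γ.slope f x η = m := by
  have h : ∃ m, Γ.HasSlope f x η m := ⟨m, hm⟩
  rw [slope, dif_pos h]
  exact h.choose_spec.unique hm

/-- Divisors: finitely supported formal integer combinations of points. -/
abbrev Divisor {V E : Type*} (Γ : MetricGraph V E) : Type _ := Γ.Point →₀ ℤ

/-- The degree of a divisor. -/
def deg {V E : Type*} (Γ : MetricGraph V E) (D : Γ.Divisor) : ℤ := D.sum fun _ n => n

/-- The coefficient `ord_x(f)` of `div(f)` at `x`. -/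
noncomputable def ord {V E : Type*} [Fintype E] (Γ : MetricGraph V E) (f : Γ.Point → ℝ)
    (x : Γ.Point) : ℤ :=
  -∑ η, Γ.slope f x η

/-- The Baker-Norine rank property for `B`: `div(f) + D ≥ B`, coefficient by coefficient. -/
def BakerNorineRankProperty {V E : Type*} [Fintype E] (Γ : MetricGraph V E) (D : Γ.Divisor)
    (f : Γ.Point → ℝ) (B : Γ.Divisor) : Prop :=
  ∀ x, B x ≤ Γ.ord f x + D x

/-- The complete linear series `R(D)`. -/
def completeSeries {V E : Type*} [Fintype E] (Γ : MetricGraph V E) (D : Γ.Divisor) :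
    Set (Γ.Point → ℝ) :=
  {f | Γ.IsPL f ∧ ∀ x, 0 ≤ Γ.ord f x + D x}

end MetricGraph

/-! ### Tropical linear algebra -/

/-- The tropical linear combination `min_{f ∈ S} (f + a_f)`. -/
noncomputable def tropicalCombination {X : Type*} (S : Finset (X → ℝ)) (hS : S.Nonempty)
    (a : (X → ℝ) → ℝ) : X → ℝ :=
  fun x => S.inf' hS fun f => f x + a f

/-- A set of functions that is closed under tropical linear combinations. -/
def IsTropicalSubmodule {X : Type*} (L : Set (X → ℝ)) : Prop :=
  ∀ (S : Finset (X → ℝ)) (hS : S.Nonempty) (a : (X → ℝ) → ℝ), (S : Set (X → ℝ)) ⊆ L →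
    tropicalCombination S hS a ∈ L

/-- A tropical submodule that consists of the tropical linear combinations of finitely many of its
elements. -/
def IsFinitelyGeneratedTropicalSubmodule {X : Type*} (L : Set (X → ℝ)) : Prop :=
  IsTropicalSubmodule L ∧ ∃ (S : Finset (X → ℝ)) (hS : S.Nonempty), (S : Set (X → ℝ)) ⊆ L ∧
    ∀ f ∈ L, ∃ a, f = tropicalCombination S hS a

/-- Tropical dependence: for suitable real numbers `a_f`, the minimum of the `f + a_f`, `f ∈ S`, is
attained at least twice at each point. -/
def TropicallyDependent {X : Type*} (S : Finset (X → ℝ)) : Prop :=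
  ∃ a : (X → ℝ) → ℝ, ∀ x, ∃ f ∈ S, ∃ g ∈ S, f ≠ g ∧ f x + a f = g x + a g ∧
    ∀ h ∈ S, f x + a f ≤ h x + a h

namespace MetricGraph

/-- `(D, L)` is a tropical linear series of rank `r`. -/
structure IsTropicalLinearSeries {V E : Type*} [Fintype E] (Γ : MetricGraph V E) (D : Γ.Divisor)
    (r : ℕ) (L : Set (Γ.Point → ℝ)) : Prop where
  subset : L ⊆ Γ.completeSeries D
  fg : IsFinitelyGeneratedTropicalSubmodule L
  rank : ∀ B : Γ.Divisor, 0 ≤ B → Γ.deg B = r → ∃ f ∈ L, Γ.BakerNorineRankProperty D f B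
  dependent : ∀ S : Finset (Γ.Point → ℝ), (S : Set (Γ.Point → ℝ)) ⊆ L → S.card = r + 2 →
    TropicallyDependent S

/-- `(D, L)` is a strongly recursive tropical linear series of rank `r`. The second clause is void
for `r = 0`; the natural number subtractions in the third are exact. -/
def IsStronglyRecursive {V E : Type*} [Fintype E] (Γ : MetricGraph V E) (D : Γ.Divisor)
    (r : ℕ) (L : Set (Γ.Point → ℝ)) : Prop :=
  Γ.IsTropicalLinearSeries D r L ∧
  (∀ k, r = k + 1 → ∀ S : Finset (Γ.Point → ℝ), (S : Set (Γ.Point → ℝ)) ⊆ L → S.card = r →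
    ∃ L' : Set (Γ.Point → ℝ), (S : Set (Γ.Point → ℝ)) ⊆ L' ∧ L' ⊆ L ∧
      Γ.IsStronglyRecursive D k L') ∧
  (∀ s₁ s₂ : ℕ, s₁ ≤ r → s₂ ≤ r → r + 2 ≤ s₁ + s₂ →
    ∀ S₁ S₂ : Finset (Γ.Point → ℝ), (S₁ : Set (Γ.Point → ℝ)) ⊆ L →
    (S₂ : Set (Γ.Point → ℝ)) ⊆ L → S₁.card = s₁ → S₂.card = s₂ →
    ∃ L₁ L₂ L₃ : Set (Γ.Point → ℝ),
      (S₁ : Set (Γ.Point → ℝ)) ⊆ L₁ ∧ L₁ ⊆ L ∧ Γ.IsStronglyRecursive D (s₁ - 1) L₁ ∧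
      (S₂ : Set (Γ.Point → ℝ)) ⊆ L₂ ∧ L₂ ⊆ L ∧ Γ.IsStronglyRecursive D (s₂ - 1) L₂ ∧
      L₃ ⊆ L₁ ∩ L₂ ∧ Γ.IsStronglyRecursive D (s₁ + s₂ - r - 2) L₃)
termination_by r
decreasing_by all_goals omega

end MetricGraph

/-! ### Dot arrays

A dot array is a subset of the grid `{0, …, r}^ι`, whose axes are indexed by a finite type `ι`, with
the componentwise order. -/

namespace DotArray

/-- The rank along the `i`-axis: the number of values of the `i`-th coordinate, minus one. -/
noncomputable def rankAlong {ι : Type*} {r : ℕ} (P : Set (ι → Fin (r + 1))) (i : ι) : ℤ :=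
  (((fun x => x i) '' P).ncard : ℤ) - 1

/-- `P` is rankable of rank `s`. -/
def HasRank {ι : Type*} {r : ℕ} (P : Set (ι → Fin (r + 1))) (s : ℤ) : Prop :=
  ∀ i, rankAlong P i = s

/-- The principal subarray `P[x]`. -/
def principal {ι : Type*} {r : ℕ} (P : Set (ι → Fin (r + 1))) (x : ι → Fin (r + 1)) :
    Set (ι → Fin (r + 1)) :=
  {y ∈ P | x ≤ y}

/-- Each principal subarray is rankable. The rank array of `P` then takes at `x` the value `s` with
`HasRank (principal P x) s`. -/
def TotallyRankable {ι : Type*} {r : ℕ} (P : Set (ι → Fin (r + 1))) : Prop :=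
  ∀ x, ∃ s, HasRank (principal P x) s

/-- The position `x` is redundant for `P`: it is the meet of at least two elements of `P`, each of
which has a coordinate in common with `x`. -/
def Redundant {ι : Type*} {r : ℕ} (P : Set (ι → Fin (r + 1))) (x : ι → Fin (r + 1)) : Prop :=
  ∃ H : Finset (ι → Fin (r + 1)), (H : Set (ι → Fin (r + 1))) ⊆ P ∧ 2 ≤ H.card ∧
    (∀ h ∈ H, ∃ i, h i = x i) ∧ IsGLB (H : Set (ι → Fin (r + 1))) x

/-- A permutation array of rank `r` on `{0, …, r}^ι`. -/
structure IsPermutationArray {ι : Type*} {r : ℕ} (P : Set (ι → Fin (r + 1))) : Prop where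
  totallyRankable : TotallyRankable P
  hasRank : HasRank P r
  not_redundant : ∀ x ∈ P, ¬ Redundant P x

/-- The redundant closure of `P`. -/
def redundantClosure {ι : Type*} {r : ℕ} (P : Set (ι → Fin (r + 1))) : Set (ι → Fin (r + 1)) :=
  P ∪ {x | Redundant P x}

/-- The standard permutation array. -/
def standard (ι : Type*) [Fintype ι] (r : ℕ) : Set (ι → Fin (r + 1)) :=
  {x | ∑ i, (x i : ℕ) = r}

end DotArray

namespace MetricGraph

/-- The tangent vector `η` at `x` lies along the segment of the edge `e` with parameters from `a` to
`b`, possibly based at an end point of it and pointing into it. -/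
def PointsInto {V E : Type*} (Γ : MetricGraph V E) (x : Γ.Point) (η : Γ.Tangent x) (e : E)
    (a b : ℝ) : Prop :=
  η.1.1 = e ∧ ((η.1.2 = true ∧ Γ.coord x η ∈ Set.Ico a b) ∨
    (η.1.2 = false ∧ Γ.coord x η ∈ Set.Ioc a b))

/-- An `r`-slope structure on `Γ`. The coordinates of the grid at `x` are indexed by the tangent
vectors at `x`. Each connected component of the complement of `verts` is made of open segments of
edges, glued at vertices of valence two. So the condition on components says that along a segment
without points of `verts` the slopes are constant in each direction and reversed for opposite
directions (`segment_same`, `segment_opposite`), and that at a point outside `verts` the slopes of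
the two tangent vectors are reversed (`through`). -/
structure SlopeStructure {V E : Type*} [Fintype E] (Γ : MetricGraph V E) (r : ℕ) where
  verts : Finset Γ.Point
  mem_verts : ∀ x, Γ.valence x ≠ 2 → x ∈ verts
  s : (x : Γ.Point) → Γ.Tangent x → Fin (r + 1) → ℤ
  s_strictMono : ∀ x η, StrictMono (s x η)
  P : (x : Γ.Point) → Set (Γ.Tangent x → Fin (r + 1))
  isPermutationArray : ∀ x, DotArray.IsPermutationArray (P x)
  segment_same : ∀ (e : E) (a b : ℝ), 0 ≤ a → a < b → b ≤ Γ.len e →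
    (∀ t ∈ Set.Ioo a b, Γ.pt e t ∉ verts) →
    ∀ (x y : Γ.Point) (η : Γ.Tangent x) (ξ : Γ.Tangent y), Γ.PointsInto x η e a b →
      Γ.PointsInto y ξ e a b → η.1.2 = ξ.1.2 → s x η = s y ξ
  segment_opposite : ∀ (e : E) (a b : ℝ), 0 ≤ a → a < b → b ≤ Γ.len e →
    (∀ t ∈ Set.Ioo a b, Γ.pt e t ∉ verts) →
    ∀ (x y : Γ.Point) (η : Γ.Tangent x) (ξ : Γ.Tangent y), Γ.PointsInto x η e a b →
      Γ.PointsInto y ξ e a b → η.1.2 ≠ ξ.1.2 → ∀ i, s x η i + s y ξ i.rev = 0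
  through : ∀ x ∉ verts, ∀ η ξ : Γ.Tangent x, η ≠ ξ → ∀ i, s x η i + s x ξ i.rev = 0
  standard : ∀ x ∉ verts, P x = DotArray.standard (Γ.Tangent x) r

/-- `∂_x(f) = j`: the slope of `f` along each `η` at `x` is the `j η`-th slope prescribed there. -/
def SlopeStructure.IsPosition {V E : Type*} [Fintype E] {Γ : MetricGraph V E} {r : ℕ}
    (𝔖 : Γ.SlopeStructure r) (f : Γ.Point → ℝ) (x : Γ.Point) (j : Γ.Tangent x → Fin (r + 1)) :
    Prop :=
  ∀ η, Γ.slope f x η = 𝔖.s x η (j η)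

/-- `R(D, 𝔖)`: the functions in `R(D)` that are compatible with `𝔖`. -/
def SlopeStructure.series {V E : Type*} [Fintype E] {Γ : MetricGraph V E} {r : ℕ}
    (𝔖 : Γ.SlopeStructure r) (D : Γ.Divisor) : Set (Γ.Point → ℝ) :=
  {f ∈ Γ.completeSeries D | ∀ x, ∃ j, 𝔖.IsPosition f x j ∧
    j ∈ DotArray.redundantClosure (𝔖.P x)}

/-- `ρ_x(f) = n`: the rank array of `P x` takes the value `n` at `∂_x(f)`. -/
def SlopeStructure.HasLocalRank {V E : Type*} [Fintype E] {Γ : MetricGraph V E} {r : ℕ}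
    (𝔖 : Γ.SlopeStructure r) (f : Γ.Point → ℝ) (x : Γ.Point) (n : ℤ) : Prop :=
  ∃ j, 𝔖.IsPosition f x j ∧ DotArray.HasRank (DotArray.principal (𝔖.P x) j) n

/-- The local rank property for `B`: `ρ_x(f) ≥ B(x)` for all `x`. (At an isolated point, where the
grid has no axes, each integer is a rank, and nothing is required.) -/
def SlopeStructure.LocalRankProperty {V E : Type*} [Fintype E] {Γ : MetricGraph V E} {r : ℕ}
    (𝔖 : Γ.SlopeStructure r) (f : Γ.Point → ℝ) (B : Γ.Divisor) : Prop :=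
  ∀ x, ∃ n, 𝔖.HasLocalRank f x n ∧ B x ≤ n

end MetricGraph

open Filter Topology

/-! Along each tangent vector a tropical linear series of rank `r` has exactly `r + 1` slopes
(`IsTropicalLinearSeries.ncard_slopeSet`): more would contradict tropical dependence, and fewer
would not allow a chip at each of `r` nearby points. Numbering the slopes gives each function in the
series a position in a grid at each point `x`. Let M be the array of these positions.

The heart of the matter is that M is totally rankable. Suppose that the positions above `y` take N +
1 values along one axis. Functions realising these values lie, by recursion, in a subseries of rank
N. Add any further `g` from it: the chosen functions have distinct slopes along that axis, so
dependence forces `g` to attain the minimum at `x`, and then in every other direction the slope of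
`g` is at least that of some chosen function (`IsTropicalLinearSeries.exists_slope_le`). So the
whole subseries lies above `y`, and its N + 1 slopes along any other axis show that the rank there
is at least N.

Discarding the redundant elements of M leaves a permutation array whose redundant closure contains
M. This is used at the vertices and at the breakpoints of a finite generating set. Elsewhere the
generators are affine, so their tropical combinations are concave, which is what the closure of the
standard array expresses.

Conversely, any slope structure compatible with the series has M in the redundant closure of its
array P, and this forces the rank array of P to be at most that of M
(`rank_le_of_subset_redundantClosure`). So a local rank of `f` at `x` that is at least `B x` yields
a subseries of some rank N ≥ `B x` whose slopes at `x` are at least those of `f`. It contains a `g`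
with ord + D ≥ N at `x`, and larger slopes mean smaller order, so `f` does at least as well. -/

/-- Finitely many values of `φ` on `L` are attained once each on a finite subset of `L`. -/
theorem Set.exists_finset_section {α β : Type*} (φ : α → β) (L : Set α) (T : Finset β)
    (hT : (T : Set β) ⊆ φ '' L) :
    ∃ S : Finset α, (S : Set α) ⊆ L ∧ S.card = T.card ∧ Set.InjOn φ S ∧ ∀ a ∈ S, φ a ∈ T := by
  classical
  have hT' : ∀ t ∈ T, ∃ a ∈ L, φ a = t := fun t ht => hT ht
  rcases T.eq_empty_or_nonempty with rfl | ⟨t₀, ht₀⟩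
  · exact ⟨∅, by simp⟩
  have : Nonempty α := ⟨(hT' t₀ ht₀).choose⟩
  choose! g hgL hg using hT'
  refine ⟨T.image g, ?_, Finset.card_image_of_injOn fun s hs t ht h => ?_, ?_, ?_⟩
  · intro a ha
    obtain ⟨t, ht, rfl⟩ := Finset.mem_image.1 ha
    exact hgL t ht
  · rw [← hg s hs, ← hg t ht, h]
  · intro a ha b hb h
    obtain ⟨s, hs, rfl⟩ := Finset.mem_image.1 ha
    obtain ⟨t, ht, rfl⟩ := Finset.mem_image.1 hb
    rw [hg s hs, hg t ht] at h
    rw [h]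
  · intro a ha
    obtain ⟨t, ht, rfl⟩ := Finset.mem_image.1 ha
    rwa [hg t ht]

/-! ### Dot arrays -/

namespace DotArray

variable {ι : Type*} {r : ℕ}

/-- Each coordinate of a meet is the minimum of that coordinate over the finite set, and the minimum
is attained. -/
theorem exists_ge_of_mem_redundantClosure {P : Set (ι → Fin (r + 1))} {x : ι → Fin (r + 1)}
    (hx : x ∈ redundantClosure P) (i : ι) : ∃ h ∈ P, x ≤ h ∧ h i = x i := by
  classical
  rcases hx with hx | ⟨H, hHP, hcard, -, hglb⟩
  · exact ⟨x, hx, le_rfl, rfl⟩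
  have hne : H.Nonempty := Finset.card_pos.1 (by omega)
  obtain ⟨h, hh, hmin⟩ := H.exists_min_image (fun h => h i) hne
  refine ⟨h, hHP hh, hglb.1 hh, le_antisymm ?_ (hglb.1 hh i)⟩
  have hz : Function.update x i (h i) ∈ lowerBounds (H : Set (ι → Fin (r + 1))) := by
    intro g hg j
    by_cases hj : j = i
    · subst hj
      simpa using hmin g hg
    · simpa [hj] using hglb.1 hg j
  simpa using hglb.2 hz i

/-- One witness per axis suffices: the meet of the witnesses is `x`. If `x` is not in `P`, no single
witness can serve all axes, so at least two are distinct. -/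
theorem mem_redundantClosure_of_forall [Finite ι] [Nonempty ι] {P : Set (ι → Fin (r + 1))}
    {x : ι → Fin (r + 1)} (hx : ∀ i, ∃ h ∈ P, x ≤ h ∧ h i = x i) : x ∈ redundantClosure P := by
  classical
  by_cases hxP : x ∈ P
  · exact Or.inl hxP
  have := Fintype.ofFinite ι
  choose h hP hle heq using hx
  refine Or.inr ⟨Finset.univ.image h, ?_, ?_, ?_, ?_, ?_⟩
  · intro y hy
    obtain ⟨i, -, rfl⟩ := Finset.mem_image.1 hy
    exact hP i
  · obtain ⟨i⟩ := ‹Nonempty ι›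
    have hix : h i ≠ x := fun e => hxP (e ▸ hP i)
    obtain ⟨k, hk⟩ := Function.ne_iff.1 hix
    refine Finset.one_lt_card.2 ⟨h i, by simp, h k, by simp, fun e => hk ?_⟩
    rw [e, heq]
  · intro y hy
    obtain ⟨i, -, rfl⟩ := Finset.mem_image.1 hy
    exact ⟨i, heq i⟩
  · intro y hy
    obtain ⟨i, -, rfl⟩ := Finset.mem_image.1 hy
    exact hle i
  · intro z hz i
    have := hz (Finset.mem_coe.2 (Finset.mem_image_of_mem h (Finset.mem_univ i))) i
    rwa [heq] at this

theorem rankAlong_mono {P Q : Set (ι → Fin (r + 1))} (h : P ⊆ Q) (i : ι) :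
    rankAlong P i ≤ rankAlong Q i := by
  have := Set.ncard_le_ncard (Set.image_mono (f := fun x : ι → Fin (r + 1) => x i) h)
    (Set.toFinite _)
  unfold rankAlong
  omega

/-- If `y` and the larger `x` differ only in the coordinate `k`, by one, and `P` has an element
above `y` with the same `k`-th coordinate, then this value of the coordinate is lost on `P[x]`. -/
theorem rankAlong_principal_eq_sub_one {P : Set (ι → Fin (r + 1))} {x y : ι → Fin (r + 1)} {k : ι}
    (hk : (x k : ℕ) = y k + 1) (hxy : ∀ i, i ≠ k → x i = y i)
    (hP : ∃ h ∈ P, y ≤ h ∧ h k = y k) :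
    rankAlong (principal P x) k = rankAlong (principal P y) k - 1 := by
  have himg : (fun z : ι → Fin (r + 1) => z k) '' principal P x
      = (fun z : ι → Fin (r + 1) => z k) '' principal P y \ {y k} := by
    ext c
    constructor
    · rintro ⟨z, ⟨hz, hxz⟩, rfl⟩
      refine ⟨⟨z, ⟨hz, fun i => ?_⟩, rfl⟩, fun h => ?_⟩
      · by_cases hi : i = k
        · subst hi
          have := Fin.le_def.1 (hxz i)
          exact Fin.le_def.2 (by omega)
        · rw [← hxy i hi]
          exact hxz i
      · have := Fin.le_def.1 (hxz k)
        have h' : z k = y k := h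
        rw [h'] at this
        omega
    · rintro ⟨⟨z, ⟨hz, hyz⟩, rfl⟩, hne⟩
      refine ⟨z, ⟨hz, fun i => ?_⟩, rfl⟩
      by_cases hi : i = k
      · subst hi
        have h1 := Fin.le_def.1 (hyz i)
        have h2 : (z i : ℕ) ≠ y i := fun h => hne (Fin.ext h)
        exact Fin.le_def.2 (by omega)
      · rw [hxy i hi]
        exact hyz i
  obtain ⟨h, hh, hyh, hhk⟩ := hP
  have hmem : y k ∈ (fun z : ι → Fin (r + 1) => z k) '' principal P y := ⟨h, ⟨hh, hyh⟩, hhk⟩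
  have := Set.ncard_sdiff_singleton_add_one hmem (Set.toFinite _)
  unfold rankAlong
  rw [himg]
  omega

/-! ### Comparison of rank arrays -/

/-- If a totally rankable array of full rank lies in the redundant closure of another one, then it
has at least the same rank array. -/
theorem rank_le_of_subset_redundantClosure [Finite ι] [Nonempty ι] {M P : Set (ι → Fin (r + 1))}
    (hM : TotallyRankable M) (hMr : HasRank M r) (hP : TotallyRankable P) (hPr : HasRank P r)
    (hMP : M ⊆ redundantClosure P) (x : ι → Fin (r + 1)) {n n' : ℤ}
    (hn : HasRank (principal P x) n) (hn' : HasRank (principal M x) n') : n ≤ n' := by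
  classical
  have := Fintype.ofFinite ι
  obtain ⟨N, hN⟩ : ∃ N, N = ∑ i, (x i : ℕ) := ⟨_, rfl⟩
  induction N using Nat.strong_induction_on generalizing x n n' with
  | _ N ih =>
  by_cases hx : ∃ k, (x k : ℕ) ≠ 0
  · obtain ⟨k, hk⟩ := hx
    -- Induction on the coordinate sum: lower one nonzero coordinate by one and compare how the two
    -- ranks drop on the way back from `y` to `x`.
    let y : ι → Fin (r + 1) := Function.update x k ⟨x k - 1, by omega⟩
    have hyk : (x k : ℕ) = y k + 1 := by simp [y]; omega
    have hy : ∀ i, i ≠ k → x i = y i := fun i hi => by simp [y, hi]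
    have hyx : y ≤ x := by
      intro i
      by_cases hi : i = k
      · subst hi; exact Fin.le_def.2 (by omega)
      · rw [hy i hi]
    have hsum : ∑ i, (y i : ℕ) < ∑ i, (x i : ℕ) :=
      Finset.sum_lt_sum (fun i _ => Fin.le_def.1 (hyx i)) ⟨k, Finset.mem_univ k, by omega⟩
    obtain ⟨m, hm⟩ := hP y
    obtain ⟨m', hm'⟩ := hM y
    have hmm := ih _ (hN ▸ hsum) y hm hm' rfl
    have hnm : n ≤ m := by
      rw [← hn k, ← hm k]
      refine rankAlong_mono ?_ k
      intro z hz
      exact ⟨hz.1, hyx.trans hz.2⟩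
    -- If M loses a value of the `k`-th coordinate, so does P, and both ranks drop by one. If M
    -- loses none, its rank is unchanged while that of P can only decrease.
    by_cases hz : ∃ z ∈ M, y ≤ z ∧ z k = y k
    · have h1 := rankAlong_principal_eq_sub_one hyk hy hz
      obtain ⟨z, hzM, hyz, hzk⟩ := hz
      obtain ⟨h, hhP, hzh, hhk⟩ := exists_ge_of_mem_redundantClosure (hMP hzM) k
      have h2 := rankAlong_principal_eq_sub_one hyk hy ⟨h, hhP, hyz.trans hzh, hhk.trans hzk⟩
      rw [hn k, hm k] at h2
      rw [hn' k, hm' k] at h1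
      omega
    · have h1 : m' ≤ n' := by
        rw [← hn' k, ← hm' k]
        refine rankAlong_mono ?_ k
        intro z hz'
        refine ⟨hz'.1, fun i => ?_⟩
        by_cases hi : i = k
        · subst hi
          have h1 := Fin.le_def.1 (hz'.2 i)
          have h2 : (z i : ℕ) ≠ y i := fun h => hz ⟨z, hz'.1, hz'.2, Fin.ext h⟩
          exact Fin.le_def.2 (by omega)
        · rw [hy i hi]
          exact hz'.2 i
      omega
  · push Not at hx
    have hall : ∀ Q : Set (ι → Fin (r + 1)), principal Q x = Q := fun Q =>
      Set.sep_eq_self_iff_mem_true.2 fun z _ i => Fin.le_def.2 (by rw [hx i]; omega)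
    rw [hall] at hn hn'
    obtain ⟨i⟩ := ‹Nonempty ι›
    rw [← hn i, ← hn' i, hPr i, hMr i]

/-! ### From totally rankable arrays to permutation arrays -/

/-- In a totally rankable array, if an element `x` shares one coordinate with a larger element, then
it shares each coordinate with some larger element. -/
theorem TotallyRankable.exists_larger {M : Set (ι → Fin (r + 1))} (hM : TotallyRankable M)
    {x y : ι → Fin (r + 1)} {i : ι} (hx : x ∈ M) (hy : y ∈ M) (hxy : x ≤ y) (hne : y ≠ x)
    (hi : y i = x i) (k : ι) : ∃ z ∈ M, x ≤ z ∧ z ≠ x ∧ z k = x k := by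
  classical
  by_contra! hcon
  have hlt : ∀ z ∈ M, x ≤ z → z ≠ x → (x k : ℕ) < z k := fun z hz hxz hzx =>
    lt_of_le_of_ne (Fin.le_def.1 (hxz k)) fun h => hcon z hz hxz hzx (Fin.ext h.symm)
  have hky := hlt y hy hxy hne
  -- If all larger elements had larger `k`-th coordinate, raising it by one would remove only `x`
  -- from the subarray. The rank along `k` would drop, but not along `i`, where `y` keeps the value
  -- `x i`.
  let w : ι → Fin (r + 1) := Function.update x k ⟨x k + 1, by omega⟩
  have hwk : (w k : ℕ) = x k + 1 := by simp [w]
  have hw : ∀ i, i ≠ k → w i = x i := fun i hi => by simp [w, hi]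
  have hge : ∀ z ∈ M, x ≤ z → z ≠ x → w ≤ z := by
    intro z hz hxz hzx j
    by_cases hj : j = k
    · subst hj
      have := hlt z hz hxz hzx
      exact Fin.le_def.2 (by omega)
    · rw [hw j hj]
      exact hxz j
  obtain ⟨s, hs⟩ := hM x
  obtain ⟨s', hs'⟩ := hM w
  have h1 := rankAlong_principal_eq_sub_one hwk hw ⟨x, hx, le_rfl, rfl⟩
  have h2 : rankAlong (principal M x) i ≤ rankAlong (principal M w) i := by
    have : (fun z : ι → Fin (r + 1) => z i) '' principal M x ⊆
        (fun z : ι → Fin (r + 1) => z i) '' principal M w := by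
      rintro _ ⟨z, ⟨hz, hxz⟩, rfl⟩
      by_cases hzx : z = x
      · subst hzx
        exact ⟨y, ⟨hy, hge y hy hxy hne⟩, hi⟩
      · exact ⟨z, ⟨hz, hge z hz hxz hzx⟩, rfl⟩
    have := Set.ncard_le_ncard this (Set.toFinite _)
    unfold rankAlong
    omega
  rw [hs, hs'] at h1 h2
  omega

/-- The non-redundant elements of a totally rankable array of full rank form a permutation array
whose redundant closure contains the array. -/
theorem TotallyRankable.exists_isPermutationArray [Finite ι] {M : Set (ι → Fin (r + 1))}
    (hM : TotallyRankable M) (hMr : HasRank M r) :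
    ∃ P, IsPermutationArray P ∧ M ⊆ redundantClosure P := by
  classical
  have hred : ∀ x ∈ M, Redundant M x → ∀ k, ∃ z ∈ M, x ≤ z ∧ z ≠ x ∧ z k = x k := by
    rintro x hx ⟨H, hHM, hcard, hsh, hglb⟩
    obtain ⟨h, hh, hhx⟩ := Finset.exists_mem_ne (s := H) (by omega) x
    obtain ⟨i, hi⟩ := hsh h hh
    exact hM.exists_larger hx (hHM hh) (hglb.1 hh) hhx hi
  let P := {x ∈ M | ¬ Redundant M x}
  have hPM : P ⊆ M := fun x hx => hx.1
  -- A maximal element of M with the prescribed `i`-th coordinate cannot be redundant, so removing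
  -- redundant elements loses no coordinate values in any principal subarray.
  have hup : ∀ x ∈ M, ∀ i, ∃ z ∈ P, x ≤ z ∧ z i = x i := by
    intro x hx i
    obtain ⟨z, hxz, hz⟩ := (Set.toFinite {z ∈ M | z i = x i}).exists_le_maximal (a := x) ⟨hx, rfl⟩
    refine ⟨z, ⟨hz.prop.1, fun hr => ?_⟩, hxz, hz.prop.2⟩
    obtain ⟨w, hw, hzw, hne, hwi⟩ := hred z hz.prop.1 hr i
    exact hne (hz.eq_of_ge ⟨hw, hwi.trans hz.prop.2⟩ hzw)
  have hrank : ∀ x i, rankAlong (principal P x) i = rankAlong (principal M x) i := by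
    intro x i
    have : (fun z : ι → Fin (r + 1) => z i) '' principal P x =
        (fun z : ι → Fin (r + 1) => z i) '' principal M x := by
      have hsub : principal P x ⊆ principal M x := by
        intro z hz
        exact ⟨hPM hz.1, hz.2⟩
      refine (Set.image_mono hsub).antisymm ?_
      rintro _ ⟨z, ⟨hz, hxz⟩, rfl⟩
      obtain ⟨w, hw, hzw, hwi⟩ := hup z hz i
      exact ⟨w, ⟨hw, hxz.trans hzw⟩, hwi⟩
    rw [rankAlong, this, rankAlong]
  refine ⟨P, ⟨fun x => ?_, fun i => ?_, ?_⟩, fun x hx => ?_⟩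
  · obtain ⟨s, hs⟩ := hM x
    exact ⟨s, fun i => (hrank x i).trans (hs i)⟩
  · have hall : ∀ Q : Set (ι → Fin (r + 1)), principal Q 0 = Q := fun Q =>
      Set.sep_eq_self_iff_mem_true.2 fun z _ i => Fin.zero_le _
    have := hrank 0 i
    rw [hall, hall] at this
    rw [this, hMr i]
  · rintro x hx ⟨H, hH, hr⟩
    exact hx.2 ⟨H, hH.trans hPM, hr⟩
  -- Without axes the grid is a single point, so nothing is redundant.
  · rcases isEmpty_or_nonempty ι with hι | hι
    · refine Or.inl ⟨hx, ?_⟩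
      rintro ⟨H, -, hcard, -⟩
      obtain ⟨h, -, hhx⟩ := Finset.exists_mem_ne (s := H) (by omega) x
      exact hhx (Subsingleton.elim _ _)
    · exact mem_redundantClosure_of_forall (hup x hx)

/-! ### The standard array on two axes -/

section Standard

variable [Fintype ι] {a b : ι}

theorem mem_standard_iff (hab : a ≠ b) (hall : ∀ i, i = a ∨ i = b) {x : ι → Fin (r + 1)} :
    x ∈ standard ι r ↔ (x a : ℕ) + x b = r := by
  classical
  have : (Finset.univ : Finset ι) = {a, b} := by ext i; simpa using hall i
  rw [standard, Set.mem_ofPred_eq, this, Finset.sum_pair hab]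

theorem standard_ext (hab : a ≠ b) (hall : ∀ i, i = a ∨ i = b) {x y : ι → Fin (r + 1)}
    (hx : x ∈ standard ι r) (hy : y ∈ standard ι r) {i : ι} (h : x i = y i) : x = y := by
  rw [mem_standard_iff hab hall] at hx hy
  have h' := congrArg Fin.val h
  have key : x a = y a ∧ x b = y b := by
    rcases hall i with rfl | rfl <;> exact ⟨Fin.ext (by omega), Fin.ext (by omega)⟩
  funext j
  rcases hall j with rfl | rfl
  exacts [key.1, key.2]

theorem exists_mem_standard (hab : a ≠ b) (hall : ∀ i, i = a ∨ i = b) (i : ι) (c : Fin (r + 1)) :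
    ∃ x ∈ standard ι r, x i = c ∧ ∀ j, j ≠ i → x j = c.rev := by
  classical
  refine ⟨fun j => if j = i then c else c.rev, ?_, by simp, fun j hj => by simp [hj]⟩
  rw [mem_standard_iff hab hall]
  have := c.isLt
  rcases hall i with rfl | rfl
  · simp only [if_true, hab.symm, if_false, Fin.val_rev]; omega
  · simp only [if_true, hab, if_false, Fin.val_rev]; omega

/-- On two axes, the standard array is a permutation array. -/
theorem isPermutationArray_standard (hab : a ≠ b) (hall : ∀ i, i = a ∨ i = b) :
    IsPermutationArray (standard ι r) := by
  -- Either coordinate determines the element, so every subarray has as many values along each axis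
  -- as elements.
  refine ⟨fun x => ⟨((principal (standard ι r) x).ncard : ℤ) - 1, fun i => ?_⟩, fun i => ?_, ?_⟩
  · rw [rankAlong, Set.InjOn.ncard_image]
    exact fun y hy z hz h => standard_ext hab hall hy.1 hz.1 h
  · have : (fun x : ι → Fin (r + 1) => x i) '' standard ι r = Set.univ :=
      Set.eq_univ_of_forall fun c =>
        let ⟨x, hx, hxi, _⟩ := exists_mem_standard hab hall i c
        ⟨x, hx, hxi⟩
    rw [rankAlong, this, Set.ncard_univ]
    simp
  · rintro x hx ⟨H, hH, hcard, hsh, -⟩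
    obtain ⟨h, hh, hhx⟩ := Finset.exists_mem_ne (s := H) (by omega) x
    obtain ⟨i, hi⟩ := hsh h hh
    exact hhx (standard_ext hab hall (hH hh) hx hi)

/-- The hypothesis says that the two coordinates sum to at most `r`; fixing either one and raising
the other reaches the antidiagonal. -/
theorem mem_redundantClosure_standard (hab : a ≠ b) (hall : ∀ i, i = a ∨ i = b)
    {x : ι → Fin (r + 1)} (hx : x a ≤ (x b).rev) : x ∈ redundantClosure (standard ι r) := by
  have : Nonempty ι := ⟨a⟩
  refine mem_redundantClosure_of_forall fun i => ?_
  obtain ⟨y, hy, hyi, hyj⟩ := exists_mem_standard hab hall i (x i)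
  refine ⟨y, hy, fun j => ?_, hyi⟩
  by_cases hji : j = i
  · rw [hji, hyi]
  rw [hyj j hji]
  rw [Fin.le_def, Fin.val_rev] at hx ⊢
  have := (x b).isLt
  rcases hall i with rfl | rfl <;> rcases hall j with rfl | rfl <;>
    first | exact absurd rfl hji | omega

end Standard

end DotArray

/-! ### Germs of affine functions and tropical combinations -/

theorem eventually_affine_lt {c₁ c₂ m₁ m₂ : ℝ} (h : c₁ < c₂ ∨ c₁ = c₂ ∧ m₁ < m₂) :
    ∀ᶠ t in 𝓝[>] (0 : ℝ), c₁ + m₁ * t < c₂ + m₂ * t := by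
  rcases h with h | ⟨rfl, h⟩
  · have h1 : ContinuousAt (fun t : ℝ => c₁ + m₁ * t) 0 := by fun_prop
    have h2 : ContinuousAt (fun t : ℝ => c₂ + m₂ * t) 0 := by fun_prop
    exact (h1.eventually_lt h2 (by simpa using h)).filter_mono nhdsWithin_le_nhds
  · filter_upwards [self_mem_nhdsWithin] with t ht
    have : m₁ * t < m₂ * t := mul_lt_mul_of_pos_right h ht
    linarith

theorem Set.Finite.exists_pos_isolated {F : Set ℝ} (hF : F.Finite) (c : ℝ) :
    ∃ δ > 0, ∀ u ∈ F, |u - c| < δ → u = c := by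
  have h : (F \ {c})ᶜ ∈ 𝓝 c := (hF.subset Set.sdiff_subset).isClosed.compl_mem_nhds (by simp)
  obtain ⟨δ, hδ, hball⟩ := Metric.mem_nhds_iff.1 h
  refine ⟨δ, hδ, fun u hu hlt => ?_⟩
  by_contra hne
  exact hball (show u ∈ Metric.ball c δ by rwa [Metric.mem_ball, Real.dist_eq]) ⟨hu, hne⟩

theorem tropicalCombination_le {X : Type*} {S : Finset (X → ℝ)} (hS : S.Nonempty)
    (a : (X → ℝ) → ℝ) {h : X → ℝ} (hh : h ∈ S) (x : X) :
    tropicalCombination S hS a x ≤ h x + a h :=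
  Finset.inf'_le (fun f : X → ℝ => f x + a f) hh

theorem le_tropicalCombination {X : Type*} {S : Finset (X → ℝ)} (hS : S.Nonempty)
    (a : (X → ℝ) → ℝ) {c : ℝ} {x : X} (h : ∀ f ∈ S, c ≤ f x + a f) :
    c ≤ tropicalCombination S hS a x :=
  Finset.le_inf' _ _ h

/-- Among finitely many germs `f x + a f + m f * t`, one is lexicographically minimal. -/
theorem exists_minimal_germ {X : Type*} {S : Finset (X → ℝ)} (hS : S.Nonempty)
    (a : (X → ℝ) → ℝ) (x : X) (m : (X → ℝ) → ℤ) :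
    ∃ f ∈ S, (∀ h ∈ S, f x + a f ≤ h x + a h) ∧
      ∀ h ∈ S, h x + a h = f x + a f → m f ≤ m h := by
  classical
  obtain ⟨f₀, hf₀, hmin₀⟩ := S.exists_min_image (fun f => f x + a f) hS
  obtain ⟨f, hf, hmin⟩ := (S.filter fun f => f x + a f = f₀ x + a f₀).exists_min_image m
    ⟨f₀, by simp [hf₀]⟩
  obtain ⟨hfS, hfeq⟩ := Finset.mem_filter.1 hf
  exact ⟨f, hfS, fun h hh => hfeq ▸ hmin₀ h hh,
    fun h hh he => hmin h (Finset.mem_filter.2 ⟨hh, he.trans hfeq⟩)⟩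

namespace MetricGraph

variable {V E : Type*} {Γ : MetricGraph V E}

/-! ### Local parametrisations -/

/-- The sign of a direction along an edge. -/
noncomputable def sign (b : Bool) : ℝ := if b then 1 else -1

theorem path_eq (x : Γ.Point) (η : Γ.Tangent x) (t : ℝ) :
    Γ.path x η t = Γ.pt η.1.1 (Γ.coord x η + sign η.1.2 * t) := by
  unfold path sign
  split_ifs <;> congr 1 <;> ring

theorem pt_interior {e : E} {t : ℝ} (h : t ∈ Set.Ioo 0 (Γ.len e)) :
    Γ.pt e t = .interior e t h := dif_pos h

theorem pt_coord (x : Γ.Point) (η : Γ.Tangent x) : Γ.pt η.1.1 (Γ.coord x η) = x := by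
  obtain ⟨⟨e, b⟩, h⟩ := η
  have := Γ.len_pos e
  cases x with
  | vertex v =>
    cases b
    · have h' : Γ.tgt e = v := h
      simp [pt, coord, h', this]
    · have h' : Γ.src e = v := h
      simp [pt, coord, h']
  | interior e' t ht =>
    have h' : e' = e := h
    subst h'
    exact pt_interior ht

theorem coord_mem (x : Γ.Point) (η : Γ.Tangent x) :
    η.1.2 = true ∧ Γ.coord x η ∈ Set.Ico 0 (Γ.len η.1.1) ∨
      η.1.2 = false ∧ Γ.coord x η ∈ Set.Ioc 0 (Γ.len η.1.1) := by
  obtain ⟨⟨e, b⟩, h⟩ := η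
  have := Γ.len_pos e
  cases x with
  | vertex v => cases b <;> simp [coord, this]
  | interior e' t ht =>
    have h' : e' = e := h
    subst h'
    cases b
    · exact Or.inr ⟨rfl, ht.1, ht.2.le⟩
    · exact Or.inl ⟨rfl, ht.1.le, ht.2⟩

@[simp] theorem path_zero (x : Γ.Point) (η : Γ.Tangent x) : Γ.path x η 0 = x := by
  rw [path_eq, mul_zero, add_zero, pt_coord]

theorem eventually_coord_mem (x : Γ.Point) (η : Γ.Tangent x) :
    ∀ᶠ t in 𝓝[>] (0 : ℝ), Γ.coord x η + sign η.1.2 * t ∈ Set.Ioo 0 (Γ.len η.1.1) := by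
  rcases coord_mem x η with ⟨hb, h⟩ | ⟨hb, h⟩
  · filter_upwards [Ioo_mem_nhdsGT (show 0 < Γ.len η.1.1 - Γ.coord x η by linarith [h.2])]
      with t ht
    simp only [hb, sign, if_true]
    constructor <;> linarith [ht.1, ht.2, h.1]
  · filter_upwards [Ioo_mem_nhdsGT h.1] with t ht
    simp only [hb, sign, Bool.false_eq_true, if_false]
    constructor <;> linarith [ht.1, ht.2, h.2]

theorem hasSlope_iff {f : Γ.Point → ℝ} {x : Γ.Point} {η : Γ.Tangent x} {m : ℤ} :
    Γ.HasSlope f x η m ↔ ∀ᶠ t in 𝓝[>] (0 : ℝ), f (Γ.path x η t) = f x + m * t := by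
  constructor
  · rintro ⟨ε, hε, h⟩
    filter_upwards [Ioo_mem_nhdsGT hε] with t ht
    exact h t ⟨ht.1.le, ht.2.le⟩
  · intro h
    obtain ⟨ε, hε, hsub⟩ := mem_nhdsGT_iff_exists_Ioo_subset.1 h
    have hε' : (0 : ℝ) < ε := hε
    refine ⟨ε / 2, by positivity, fun t ht => ?_⟩
    rcases ht.1.eq_or_lt with h0 | h0
    · simp [← h0]
    · exact hsub ⟨h0, by linarith [ht.2]⟩

/-! ### Piecewise linear functions -/

/-- `f` is affine on the segment of `e` from `a` to `b`. -/
def AffineOn (Γ : MetricGraph V E) (f : Γ.Point → ℝ) (e : E) (a b : ℝ) (m : ℤ) : Prop :=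
  ∃ c : ℝ, ∀ t ∈ Set.Icc a b, f (Γ.pt e t) = c + m * t

theorem IsPL.exists_breakpoints {f : Γ.Point → ℝ} (hf : Γ.IsPL f) (e : E) :
    ∃ F : Set ℝ, F.Finite ∧ ∀ a b, 0 ≤ a → a < b → b ≤ Γ.len e → (∀ t ∈ Set.Ioo a b, t ∉ F) →
      ∃ m, Γ.AffineOn f e a b m := by
  classical
  obtain ⟨n, p, hp, h0, hn, haff⟩ := hf e
  refine ⟨p '' Set.Iic n, (Set.finite_Iic n).image p, fun a b ha hab hb hF => ?_⟩
  -- No breakpoint lies strictly between `a` and `b`, so the piece that contains the midpoint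
  -- contains the whole segment.
  have hex : ∃ k, (a + b) / 2 ≤ p k := ⟨n, by linarith⟩
  obtain ⟨i, hi⟩ : ∃ i, Nat.find hex = i + 1 := by
    refine Nat.exists_eq_succ_of_ne_zero fun h => ?_
    have := Nat.find_spec hex
    rw [h, h0] at this
    linarith
  have hin : i + 1 ≤ n := hi ▸ Nat.find_min' hex (show (a + b) / 2 ≤ p n by linarith)
  have h1 : (a + b) / 2 ≤ p (i + 1) := hi ▸ Nat.find_spec hex
  have h2 : p i < (a + b) / 2 := not_le.1 (Nat.find_min hex (by omega))
  have hia : p i ≤ a := by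
    by_contra! h
    exact hF (p i) ⟨h, by linarith⟩ ⟨i, Set.mem_Iic.2 (by omega), rfl⟩
  have hib : b ≤ p (i + 1) := by
    by_contra! h
    exact hF (p (i + 1)) ⟨by linarith, h⟩ ⟨i + 1, Set.mem_Iic.2 hin, rfl⟩
  obtain ⟨m, hm⟩ := haff i (by omega)
  refine ⟨m, f (Γ.pt e (p i)) - m * p i, fun t ht => ?_⟩
  rw [hm t ⟨hia.trans ht.1, ht.2.trans hib⟩]
  ring

theorem AffineOn.hasSlope {f : Γ.Point → ℝ} {e : E} {a b : ℝ} {m : ℤ}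
    (h : Γ.AffineOn f e a b m) {x : Γ.Point} {η : Γ.Tangent x} (hη : Γ.PointsInto x η e a b) :
    Γ.HasSlope f x η (if η.1.2 then m else -m) := by
  obtain ⟨c, hc⟩ := h
  obtain ⟨rfl, hη⟩ := hη
  have hx : f x = c + m * Γ.coord x η := by
    rw [← hc (Γ.coord x η), pt_coord]
    rcases hη with ⟨-, h⟩ | ⟨-, h⟩
    exacts [⟨h.1, h.2.le⟩, ⟨h.1.le, h.2⟩]
  rw [hasSlope_iff]
  rcases hη with ⟨hb, h⟩ | ⟨hb, h⟩
  · filter_upwards [Ioo_mem_nhdsGT (sub_pos.2 h.2)] with t ht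
    rw [path_eq, hb, hc _ (by constructor <;> simp only [sign, if_true] <;>
      linarith [ht.1, ht.2, h.1]), hx]
    simp only [sign, if_true]
    ring
  · filter_upwards [Ioo_mem_nhdsGT (sub_pos.2 h.1)] with t ht
    rw [path_eq, hb, hc _ (by constructor <;> simp only [sign, Bool.false_eq_true, if_false] <;>
      linarith [ht.1, ht.2, h.2]), hx]
    simp only [sign, Bool.false_eq_true, if_false]
    push_cast
    ring

/-- Each tangent vector points into a segment whose interior avoids a given finite set. -/
theorem exists_pointsInto {e : E} {F : Set ℝ} (hF : F.Finite) (x : Γ.Point) (η : Γ.Tangent x)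
    (he : η.1.1 = e) : ∃ a b, 0 ≤ a ∧ a < b ∧ b ≤ Γ.len e ∧ (∀ t ∈ Set.Ioo a b, t ∉ F) ∧
      Γ.PointsInto x η e a b := by
  subst he
  obtain ⟨δ, hδ, hiso⟩ := hF.exists_pos_isolated (Γ.coord x η)
  rcases coord_mem x η with ⟨hb, h⟩ | ⟨hb, h⟩
  · have hlt : Γ.coord x η < min (Γ.coord x η + δ) (Γ.len η.1.1) := lt_min (by linarith) h.2
    refine ⟨Γ.coord x η, min (Γ.coord x η + δ) (Γ.len η.1.1), h.1, hlt,
      min_le_right _ _, fun t ht htF => ?_, rfl, Or.inl ⟨hb, le_rfl, hlt⟩⟩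
    have h1 := ht.2.trans_le (min_le_left _ _)
    have := hiso t htF (by rw [abs_lt]; constructor <;> linarith [ht.1])
    exact ht.1.ne' this
  · have hlt : max (Γ.coord x η - δ) 0 < Γ.coord x η := max_lt (by linarith) h.1
    refine ⟨max (Γ.coord x η - δ) 0, Γ.coord x η, le_max_right _ _, hlt, h.2,
      fun t ht htF => ?_, rfl, Or.inr ⟨hb, hlt, le_rfl⟩⟩
    have h1 := (le_max_left _ _).trans_lt ht.1
    have := hiso t htF (by rw [abs_lt]; constructor <;> linarith [ht.2])
    exact ht.2.ne this

theorem IsPL.hasSlope {f : Γ.Point → ℝ} (hf : Γ.IsPL f) (x : Γ.Point) (η : Γ.Tangent x) :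
    Γ.HasSlope f x η (Γ.slope f x η) := by
  obtain ⟨F, hF, hFa⟩ := hf.exists_breakpoints η.1.1
  obtain ⟨a, b, ha, hab, hb, havoid, hη⟩ := exists_pointsInto hF x η rfl
  obtain ⟨m, hm⟩ := hFa a b ha hab hb havoid
  have := hm.hasSlope hη
  rwa [this.slope_eq]

/-! ### Slopes of tropical combinations -/

section Germ

variable {S : Finset (Γ.Point → ℝ)} {x : Γ.Point} {η : Γ.Tangent x}

/-- Germs of affine functions are ordered lexicographically by value and slope. Hence a
lexicographically least one stays minimal just beyond `x`, and ties there only with terms of the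
same value and slope. -/
theorem eventually_minimal_germ (hPL : ∀ h ∈ S, Γ.IsPL h) (a : (Γ.Point → ℝ) → ℝ)
    {f : Γ.Point → ℝ} (hf : f ∈ S) (hmin : ∀ h ∈ S, f x + a f ≤ h x + a h)
    (hmin' : ∀ h ∈ S, h x + a h = f x + a f → Γ.slope f x η ≤ Γ.slope h x η) :
    ∀ᶠ t in 𝓝[>] (0 : ℝ), ∀ h ∈ S, f (Γ.path x η t) + a f ≤ h (Γ.path x η t) + a h ∧
      (h (Γ.path x η t) + a h = f (Γ.path x η t) + a f →
        h x + a h = f x + a f ∧ Γ.slope h x η = Γ.slope f x η) := by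
  refine (Finset.eventually_all S).2 fun h hh => ?_
  have hsf := hasSlope_iff.1 ((hPL f hf).hasSlope x η)
  have hsh := hasSlope_iff.1 ((hPL h hh).hasSlope x η)
  by_cases heq : h x + a h = f x + a f ∧ Γ.slope h x η = Γ.slope f x η
  · filter_upwards [hsf, hsh] with t h1 h2
    refine ⟨?_, fun _ => heq⟩
    rw [h1, h2, heq.2]
    linarith [heq.1]
  · have hlex : f x + a f < h x + a h ∨
        f x + a f = h x + a h ∧ (Γ.slope f x η : ℝ) < Γ.slope h x η := by
      rcases (hmin h hh).lt_or_eq with hlt | he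
      · exact Or.inl hlt
      · refine Or.inr ⟨he, Int.cast_lt.2 (lt_of_le_of_ne (hmin' h hh he.symm) fun hs => ?_)⟩
        exact heq ⟨he.symm, hs.symm⟩
    filter_upwards [hsf, hsh, eventually_affine_lt hlex] with t h1 h2 h3
    rw [h1, h2]
    exact ⟨by linarith, fun h4 => absurd h4 (by linarith)⟩

/-- Near each point and in each direction, a tropical combination agrees with one of its terms: one
with the least slope among those that attain the minimum at the point. -/
theorem exists_slope_tropicalCombination (hPL : ∀ h ∈ S, Γ.IsPL h) (hS : S.Nonempty)
    (a : (Γ.Point → ℝ) → ℝ) (x : Γ.Point) (η : Γ.Tangent x) :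
    ∃ g ∈ S, g x + a g = tropicalCombination S hS a x ∧
      Γ.slope (tropicalCombination S hS a) x η = Γ.slope g x η ∧
      ∀ h ∈ S, h x + a h = tropicalCombination S hS a x → Γ.slope g x η ≤ Γ.slope h x η := by
  obtain ⟨g, hg, hmin, hmin'⟩ := exists_minimal_germ hS a x fun h => Γ.slope h x η
  have hval : ∀ y, (∀ h ∈ S, g y + a g ≤ h y + a h) → tropicalCombination S hS a y = g y + a g :=
    fun y hy => (tropicalCombination_le hS a hg y).antisymm (le_tropicalCombination hS a hy)
  have hx := hval x hmin
  refine ⟨g, hg, hx.symm, HasSlope.slope_eq (hasSlope_iff.2 ?_), fun h hh he => ?_⟩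
  · filter_upwards [eventually_minimal_germ hPL a hg hmin hmin',
      hasSlope_iff.1 ((hPL g hg).hasSlope x η)] with t h1 h2
    rw [hval _ fun h hh => (h1 h hh).1, h2, hx]
    ring
  · exact hmin' h hh (he.trans hx)

/-- In a tropically dependent set, in each direction at each point the least slope among the terms
that attain the minimum is attained twice. -/
theorem exists_pair_of_tropicallyDependent (hPL : ∀ h ∈ S, Γ.IsPL h) {a : (Γ.Point → ℝ) → ℝ}
    (ha : ∀ x, ∃ f ∈ S, ∃ g ∈ S, f ≠ g ∧ f x + a f = g x + a g ∧ ∀ h ∈ S, f x + a f ≤ h x + a h)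
    (x : Γ.Point) (η : Γ.Tangent x) :
    ∃ f ∈ S, ∃ g ∈ S, f ≠ g ∧ (∀ h ∈ S, f x + a f ≤ h x + a h) ∧ g x + a g = f x + a f ∧
      Γ.slope f x η = Γ.slope g x η ∧
      ∀ h ∈ S, h x + a h = f x + a f → Γ.slope f x η ≤ Γ.slope h x η := by
  obtain ⟨f₀, hf₀, -⟩ := ha x
  obtain ⟨m, hm, hmin, hmin'⟩ := exists_minimal_germ ⟨f₀, hf₀⟩ a x fun h => Γ.slope h x η
  -- Apply dependence not at `x` but slightly along `η`, where a tie implies equal slopes.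
  obtain ⟨t, ht⟩ := (eventually_minimal_germ hPL a hm hmin hmin').exists
  obtain ⟨f, hf, g, hg, hne, hfg, hle⟩ := ha (Γ.path x η t)
  have hfm := (hle m hm).antisymm (ht f hf).1
  obtain ⟨hf1, hf2⟩ := (ht f hf).2 hfm
  obtain ⟨hg1, hg2⟩ := (ht g hg).2 (hfg.symm.trans hfm)
  refine ⟨f, hf, g, hg, hne, fun h hh => hf1 ▸ hmin h hh, hg1.trans hf1.symm, hf2.trans hg2.symm,
    fun h hh he => hf2 ▸ hmin' h hh (he.trans hf1)⟩

end Germ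

end MetricGraph

/-! ### Counting the slopes of affine functions -/

/-- If finitely many affine functions with integer slopes have two minimal ones of different slopes
at each of `r` points, then they have at least `r + 1` slopes. -/
theorem succ_le_card_slopes {α : Type*} {S : Finset α} (hS : S.Nonempty) (c : α → ℝ)
    (m : α → ℤ) (r : ℕ) (t : ℕ → ℝ) (ht : StrictMono t)
    (h : ∀ i < r, ∃ g₁ ∈ S, ∃ g₂ ∈ S, m g₁ < m g₂ ∧
      (∀ k ∈ S, c g₁ + m g₁ * t i ≤ c k + m k * t i) ∧
      ∀ k ∈ S, c g₂ + m g₂ * t i ≤ c k + m k * t i) :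
    r + 1 ≤ (S.image m).card := by
  classical
  obtain ⟨g₀, hg₀⟩ := hS
  rcases r.eq_zero_or_pos with rfl | hr
  · exact Finset.card_pos.2 ⟨m g₀, Finset.mem_image_of_mem m hg₀⟩
  have : Nonempty α := ⟨g₀⟩
  choose! p hp q hq hpq hpmin hqmin using h
  -- Concavity of a minimum of affine functions: the larger slope at a later point is at most the
  -- smaller slope at an earlier one.
  have key : ∀ i < r, ∀ j < r, i < j → m (q j) ≤ m (p i) := by
    intro i hi j hj hij
    have h1 := hpmin i hi (q j) (hq j hj)
    have h2 := hqmin j hj (p i) (hp i hi)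
    have h3 : ((m (q j) : ℝ) - m (p i)) * (t j - t i) ≤ 0 := by nlinarith
    have h4 : (m (q j) : ℝ) - m (p i) ≤ 0 := nonpos_of_mul_nonpos_left h3 (sub_pos.2 (ht hij))
    exact_mod_cast sub_nonpos.1 h4
  have hinj : Set.InjOn (fun i => m (p i)) (Finset.range r : Set ℕ) := by
    intro i hi j hj hij
    have hi' : i < r := by simpa using hi
    have hj' : j < r := by simpa using hj
    have hij' : m (p i) = m (p j) := hij
    rcases lt_trichotomy i j with hlt | he | hlt
    · have := key i hi' j hj' hlt
      have := hpq j hj'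
      omega
    · exact he
    · have := key j hj' i hi' hlt
      have := hpq i hi'
      omega
  -- The smaller slopes at the `r` points are distinct; the larger slope at the first point exceeds
  -- them all and is the additional one.
  have hnot : m (q 0) ∉ (Finset.range r).image fun i => m (p i) := by
    intro hmem
    obtain ⟨i, hi, he⟩ := Finset.mem_image.1 hmem
    have hi' : i < r := by simpa using hi
    have := hpq 0 hr
    rcases i.eq_zero_or_pos with rfl | hpos
    · omega
    · have := key 0 hr i hi' hpos
      have := hpq i hi'
      omega
  calc r + 1 = (insert (m (q 0)) ((Finset.range r).image fun i => m (p i))).card := by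
        rw [Finset.card_insert_of_notMem hnot, Finset.card_image_of_injOn hinj, Finset.card_range]
    _ ≤ _ := by
        refine Finset.card_le_card fun y hy => ?_
        rcases Finset.mem_insert.1 hy with rfl | hy
        · exact Finset.mem_image_of_mem m (hq 0 hr)
        · obtain ⟨i, hi, rfl⟩ := Finset.mem_image.1 hy
          exact Finset.mem_image_of_mem m (hp i (by simpa using hi))

namespace MetricGraph

variable {V E : Type*} {Γ : MetricGraph V E}

/-! ### Interior points of edges -/

/-- The two tangent vectors at an interior point of an edge. -/
def interiorTangent (Γ : MetricGraph V E) (e : E) (u : ℝ) (hu : u ∈ Set.Ioo 0 (Γ.len e))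
    (b : Bool) : Γ.Tangent (.interior e u hu) := ⟨(e, b), rfl⟩

theorem interiorTangent_ne (e : E) (u : ℝ) (hu : u ∈ Set.Ioo 0 (Γ.len e)) :
    Γ.interiorTangent e u hu true ≠ Γ.interiorTangent e u hu false := fun h => by
  simpa [interiorTangent] using congrArg (fun η => η.1.2) h

theorem eq_interiorTangent {e : E} {u : ℝ} {hu : u ∈ Set.Ioo 0 (Γ.len e)}
    (η : Γ.Tangent (.interior e u hu)) :
    η = Γ.interiorTangent e u hu true ∨ η = Γ.interiorTangent e u hu false := by
  obtain ⟨⟨e', b⟩, h⟩ := η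
  have h' : e = e' := h
  subst h'
  cases b
  exacts [Or.inr rfl, Or.inl rfl]

theorem ord_interior [Fintype E] (f : Γ.Point → ℝ) (e : E) (u : ℝ)
    (hu : u ∈ Set.Ioo 0 (Γ.len e)) (b : Bool) :
    Γ.ord f (.interior e u hu) = -(Γ.slope f _ (Γ.interiorTangent e u hu b) +
      Γ.slope f _ (Γ.interiorTangent e u hu !b)) := by
  classical
  have huniv : (Finset.univ : Finset (Γ.Tangent (.interior e u hu))) =
      {Γ.interiorTangent e u hu true, Γ.interiorTangent e u hu false} := by
    ext η
    simpa using eq_interiorTangent η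
  rw [ord, huniv, Finset.sum_pair (interiorTangent_ne e u hu)]
  cases b
  · rw [add_comm]; rfl
  · rfl

theorem path_interiorTangent (x : Γ.Point) (η : Γ.Tangent x) (t s : ℝ)
    (hu : Γ.coord x η + sign η.1.2 * t ∈ Set.Ioo 0 (Γ.len η.1.1)) :
    Γ.path _ (Γ.interiorTangent η.1.1 _ hu η.1.2) s = Γ.path x η (t + s) ∧
      Γ.path _ (Γ.interiorTangent η.1.1 _ hu !η.1.2) s = Γ.path x η (t - s) := by
  have hsign : sign (!η.1.2) = - sign η.1.2 := by cases η.1.2 <;> simp [sign]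
  constructor
  · rw [path_eq, path_eq]
    simp only [interiorTangent, coord]
    congr 1
    ring
  · rw [path_eq, path_eq]
    simp only [interiorTangent, coord, hsign]
    congr 1
    ring

/-- A function that is affine along a path has opposite slopes at the points of the path. -/
theorem hasSlope_interiorTangent {f : Γ.Point → ℝ} {x : Γ.Point} {η : Γ.Tangent x} {m : ℤ} {ε : ℝ}
    (h : ∀ t ∈ Set.Ioo 0 ε, f (Γ.path x η t) = f x + m * t) {t : ℝ} (ht : t ∈ Set.Ioo 0 ε)
    (hu : Γ.coord x η + sign η.1.2 * t ∈ Set.Ioo 0 (Γ.len η.1.1)) :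
    Γ.HasSlope f _ (Γ.interiorTangent η.1.1 _ hu η.1.2) m ∧
      Γ.HasSlope f _ (Γ.interiorTangent η.1.1 _ hu !η.1.2) (-m) := by
  have h0 : f (.interior η.1.1 _ hu) = f x + m * t := by
    rw [← h t ht, path_eq, pt_interior hu]
  rw [hasSlope_iff, hasSlope_iff]
  constructor
  · filter_upwards [Ioo_mem_nhdsGT (sub_pos.2 ht.2)] with s hs
    rw [(path_interiorTangent x η t s hu).1, h0,
      h _ (by constructor <;> linarith [ht.1, ht.2, hs.1, hs.2])]
    ring
  · filter_upwards [Ioo_mem_nhdsGT ht.1] with s hs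
    rw [(path_interiorTangent x η t s hu).2, h0,
      h _ (by constructor <;> linarith [ht.1, ht.2, hs.1, hs.2])]
    push_cast
    ring

theorem finite_setOf_pt_mem {K : Set Γ.Point} (hK : K.Finite) (e : E) :
    {u ∈ Set.Ioo 0 (Γ.len e) | Γ.pt e u ∈ K}.Finite := by
  refine Set.Finite.of_finite_image (f := Γ.pt e) (hK.subset ?_) ?_
  · rintro _ ⟨u, hu, rfl⟩
    exact hu.2
  · intro u hu v hv huv
    rw [pt_interior hu.1, pt_interior hv.1] at huv
    simpa using huv

theorem eventually_divisor_eq_zero (D : Γ.Divisor) (x : Γ.Point) (η : Γ.Tangent x) :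
    ∀ᶠ t in 𝓝[>] (0 : ℝ), D (Γ.path x η t) = 0 := by
  have hF := finite_setOf_pt_mem D.support.finite_toSet η.1.1
  obtain ⟨δ, hδ, hiso⟩ := hF.exists_pos_isolated (Γ.coord x η)
  filter_upwards [eventually_coord_mem x η, Ioo_mem_nhdsGT hδ] with t ht htδ
  by_contra hne
  have habs : |sign η.1.2 * t| = t := by
    rw [abs_mul, abs_of_pos htδ.1]
    cases η.1.2 <;> simp [sign]
  have := hiso (Γ.coord x η + sign η.1.2 * t)
    ⟨ht, by rwa [Finset.mem_coe, Finsupp.mem_support_iff, ← path_eq]⟩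
    (by rw [add_sub_cancel_left, habs]; exact htδ.2)
  rw [add_eq_left] at this
  rw [this, abs_zero] at habs
  exact htδ.1.ne habs

/-! ### Slopes of tropical linear series -/

/-- The slopes along `η` of the functions in `L`. -/
def slopeSet (Γ : MetricGraph V E) (L : Set (Γ.Point → ℝ)) (x : Γ.Point) (η : Γ.Tangent x) :
    Set ℤ := (fun f => Γ.slope f x η) '' L

section Series

variable [Fintype E] {D : Γ.Divisor} {r : ℕ} {L : Set (Γ.Point → ℝ)}

theorem IsTropicalLinearSeries.isPL (hL : Γ.IsTropicalLinearSeries D r L) {f : Γ.Point → ℝ}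
    (hf : f ∈ L) : Γ.IsPL f := (hL.subset hf).1

omit [Fintype E] in
-- Tropical combinations create no new slopes, so finitely many generators account for all of them.
theorem slopeSet_eq_image {S : Finset (Γ.Point → ℝ)} (hS : S.Nonempty)
    (hPL : ∀ f ∈ L, Γ.IsPL f) (hSL : (S : Set (Γ.Point → ℝ)) ⊆ L)
    (hgen : ∀ f ∈ L, ∃ a, f = tropicalCombination S hS a) (x : Γ.Point) (η : Γ.Tangent x) :
    Γ.slopeSet L x η = (fun f => Γ.slope f x η) '' (S : Set (Γ.Point → ℝ)) := by
  refine Set.Subset.antisymm ?_ (Set.image_mono hSL)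
  rintro _ ⟨f, hf, rfl⟩
  obtain ⟨a, rfl⟩ := hgen f hf
  obtain ⟨g, hg, -, hslope, -⟩ :=
    exists_slope_tropicalCombination (fun h hh => hPL h (hSL hh)) hS a x η
  exact ⟨g, hg, hslope.symm⟩

theorem IsTropicalLinearSeries.finite_slopeSet (hL : Γ.IsTropicalLinearSeries D r L)
    (x : Γ.Point) (η : Γ.Tangent x) : (Γ.slopeSet L x η).Finite := by
  obtain ⟨-, S, hS, hSL, hgen⟩ := hL.fg
  rw [slopeSet_eq_image hS (fun f => hL.isPL) hSL hgen]
  exact S.finite_toSet.image _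

/-- Functions with `r + 2` distinct slopes along `η` would be dependent, but dependence makes two of
the slopes coincide. -/
theorem IsTropicalLinearSeries.ncard_slopeSet_le (hL : Γ.IsTropicalLinearSeries D r L)
    (x : Γ.Point) (η : Γ.Tangent x) : (Γ.slopeSet L x η).ncard ≤ r + 1 := by
  by_contra! hlt
  obtain ⟨T, hT, hTcard⟩ := Set.exists_subset_card_eq (show r + 2 ≤ (Γ.slopeSet L x η).ncard by omega)
  have hTfin := (hL.finite_slopeSet x η).subset hT
  obtain ⟨S, hSL, hScard, hinj, -⟩ := Set.exists_finset_section (fun f => Γ.slope f x η) L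
    hTfin.toFinset (by simpa [slopeSet] using hT)
  rw [← Set.ncard_eq_toFinset_card T hTfin, hTcard] at hScard
  obtain ⟨a, ha⟩ := hL.dependent S hSL hScard
  obtain ⟨f, hf, g, hg, hne, -, -, hfg, -⟩ :=
    exists_pair_of_tropicallyDependent (fun h hh => hL.isPL (hSL hh)) ha x η
  exact hne (hinj hf hg hfg)

theorem IsTropicalLinearSeries.ncard_slopeSet (hL : Γ.IsTropicalLinearSeries D r L)
    (x : Γ.Point) (η : Γ.Tangent x) : (Γ.slopeSet L x η).ncard = r + 1 := by
  classical
  refine (hL.ncard_slopeSet_le x η).antisymm ?_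
  obtain ⟨-, S, hS, hSL, hgen⟩ := hL.fg
  have hSPL : ∀ h ∈ S, Γ.IsPL h := fun h hh => hL.isPL (hSL hh)
  have hev : ∀ᶠ t in 𝓝[>] (0 : ℝ), (∀ g ∈ S, g (Γ.path x η t) = g x + Γ.slope g x η * t) ∧
      D (Γ.path x η t) = 0 ∧ Γ.coord x η + sign η.1.2 * t ∈ Set.Ioo 0 (Γ.len η.1.1) :=
    ((Finset.eventually_all S).2 fun g hg => hasSlope_iff.1 ((hSPL g hg).hasSlope x η)).and
      ((eventually_divisor_eq_zero D x η).and (eventually_coord_mem x η))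
  obtain ⟨ε, hε, hsub⟩ := mem_nhdsGT_iff_exists_Ioo_subset.1 hev
  have hε' : (0 : ℝ) < ε := hε
  -- For `i < r` these parameters lie in `(0, ε)`, where all generators are affine, `D` vanishes and
  -- the path stays inside the edge.
  let t : ℕ → ℝ := fun i => ε * ((i + 1) / (r + 1))
  have ht : StrictMono t := by
    intro i j hij
    have : (i : ℝ) < j := by exact_mod_cast hij
    dsimp only [t]
    gcongr
  have htε : ∀ i < r, t i ∈ Set.Ioo 0 ε := by
    intro i hi
    have : (i : ℝ) < r := by exact_mod_cast hi
    refine ⟨by positivity, mul_lt_of_lt_one_right hε' ?_⟩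
    rw [div_lt_one (by positivity)]
    linarith
  let B : Γ.Divisor := ∑ i ∈ Finset.range r, Finsupp.single (Γ.path x η (t i)) 1
  have hB : 0 ≤ B := Finset.sum_nonneg fun i _ => by simp
  have hBdeg : Γ.deg B = r := by
    rw [deg, ← Finsupp.sum_finsetSum_index (fun _ => rfl) fun _ _ _ => rfl]
    simp
  have hBt : ∀ i < r, 1 ≤ B (Γ.path x η (t i)) := by
    intro i hi
    rw [Finsupp.finsetSum_apply]
    refine le_trans ?_ (Finset.single_le_sum (fun j _ => ?_) (Finset.mem_range.2 hi))
    · simp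
    · rw [Finsupp.single_apply]
      split_ifs <;> simp
  obtain ⟨f, hf, hfB⟩ := hL.rank B hB hBdeg
  obtain ⟨a, rfl⟩ := hgen f hf
  have hslopes := succ_le_card_slopes hS (fun g => g x + a g) (fun g => Γ.slope g x η) r t ht ?_
  · refine hslopes.trans ?_
    rw [slopeSet_eq_image hS (fun f => hL.isPL) hSL hgen, ← Finset.coe_image,
      Set.ncard_coe_finset]
  intro i hi
  obtain ⟨-, hD0, hu⟩ := hsub (htε i hi)
  have hpt : Γ.path x η (t i) = .interior η.1.1 _ hu := by rw [path_eq, pt_interior hu]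
  have hgs : ∀ g ∈ S, Γ.slope g _ (Γ.interiorTangent η.1.1 _ hu η.1.2) = Γ.slope g x η ∧
      Γ.slope g _ (Γ.interiorTangent η.1.1 _ hu !η.1.2) = -Γ.slope g x η := by
    intro g hg
    have := hasSlope_interiorTangent (fun s hs => (hsub hs).1 g hg) (htε i hi) hu
    exact ⟨this.1.slope_eq, this.2.slope_eq⟩
  -- A chip where `D` vanishes means that the combination bends strictly: the generators that govern
  -- the two directions have different slopes.
  have hord := (hBt i hi).trans (hfB _)
  rw [hD0, hpt, ord_interior _ _ _ hu η.1.2] at hord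
  obtain ⟨g₁, hg₁, hact₁, hs₁, -⟩ := exists_slope_tropicalCombination hSPL hS a _
    (Γ.interiorTangent η.1.1 _ hu η.1.2)
  obtain ⟨g₂, hg₂, hact₂, hs₂, -⟩ := exists_slope_tropicalCombination hSPL hS a _
    (Γ.interiorTangent η.1.1 _ hu !η.1.2)
  rw [hs₁, hs₂, (hgs g₁ hg₁).1, (hgs g₂ hg₂).2] at hord
  have hmin : ∀ g ∈ S, g (Γ.path x η (t i)) + a g = tropicalCombination S hS a (Γ.path x η (t i)) →
      ∀ k ∈ S, g x + a g + Γ.slope g x η * t i ≤ k x + a k + Γ.slope k x η * t i := by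
    intro g hg he k hk
    have := tropicalCombination_le hS a hk (Γ.path x η (t i))
    rw [← he, (hsub (htε i hi)).1 g hg, (hsub (htε i hi)).1 k hk] at this
    linarith
  rw [← hpt] at hact₁ hact₂
  exact ⟨g₁, hg₁, g₂, hg₂, by omega, hmin g₁ hg₁ hact₁, hmin g₂ hg₂ hact₂⟩

/-! ### Slopes in subseries that contain given functions -/

/-- If `r + 1` functions in a series of rank `r` have different slopes along one tangent vector at
`x`, then along each tangent vector at `x` one of them has the least slope in the series. -/
theorem IsTropicalLinearSeries.exists_slope_le (hL : Γ.IsTropicalLinearSeries D r L)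
    {S : Finset (Γ.Point → ℝ)} (hSL : (S : Set (Γ.Point → ℝ)) ⊆ L) (hcard : S.card = r + 1)
    {x : Γ.Point} {η : Γ.Tangent x} (hinj : Set.InjOn (fun f => Γ.slope f x η) (S : Set (Γ.Point → ℝ)))
    {g : Γ.Point → ℝ} (hg : g ∈ L) (ξ : Γ.Tangent x) : ∃ f ∈ S, Γ.slope f x ξ ≤ Γ.slope g x ξ := by
  classical
  by_cases hgS : g ∈ S
  · exact ⟨g, hgS, le_rfl⟩
  have hsub : ((insert g S : Finset (Γ.Point → ℝ)) : Set (Γ.Point → ℝ)) ⊆ L := by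
    rw [Finset.coe_insert]
    exact Set.insert_subset hg hSL
  have hPL : ∀ h ∈ insert g S, Γ.IsPL h := fun h hh => hL.isPL (hsub hh)
  obtain ⟨a, ha⟩ := hL.dependent (insert g S) hsub (by rw [Finset.card_insert_of_notMem hgS, hcard])
  -- The slopes of `S` along `η` are distinct, so the minimal pair of equal slopes includes `g`; in
  -- particular `g` attains the minimum at `x`.
  have hact : ∀ h ∈ insert g S, g x + a g ≤ h x + a h := by
    obtain ⟨f₁, hf₁, f₂, hf₂, hne, hmin, heq, hs, -⟩ :=
      exists_pair_of_tropicallyDependent hPL ha x η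
    rcases Finset.mem_insert.1 hf₁ with rfl | h₁
    · exact hmin
    rcases Finset.mem_insert.1 hf₂ with rfl | h₂
    · rwa [heq]
    · exact absurd (hinj h₁ h₂ hs) hne
  obtain ⟨f₁, hf₁, f₂, hf₂, hne, hmin, heq, hs, hle⟩ :=
    exists_pair_of_tropicallyDependent hPL ha x ξ
  have hgle := hle g (Finset.mem_insert_self g S)
    ((hact f₁ hf₁).antisymm (hmin g (Finset.mem_insert_self g S)))
  rcases Finset.mem_insert.1 hf₁ with rfl | h₁
  · rcases Finset.mem_insert.1 hf₂ with rfl | h₂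
    · exact absurd rfl hne
    · exact ⟨f₂, h₂, hs ▸ hgle⟩
  · exact ⟨f₁, h₁, hgle⟩

/-- Adding constants gives infinitely many functions, a supply for enlarging small sets to the size
that the recursion requires. -/
theorem IsTropicalLinearSeries.infinite (hL : Γ.IsTropicalLinearSeries D r L) (x : Γ.Point) :
    L.Infinite := by
  obtain ⟨hsub, S, ⟨f, hf⟩, hSL, -⟩ := hL.fg
  refine Set.infinite_of_injective_forall_mem (f := fun (c : ℝ) y => f y + c) ?_ fun c => ?_
  · intro c d h
    simpa using congrFun h x
  · have := hsub {f} (Finset.singleton_nonempty f) (fun _ => c) (by simpa using hSL hf)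
    have he : tropicalCombination {f} (Finset.singleton_nonempty f) (fun _ => c) =
        fun y => f y + c := by
      funext y
      simp [tropicalCombination]
    rwa [he] at this

theorem IsStronglyRecursive.isTropicalLinearSeries (hL : Γ.IsStronglyRecursive D r L) :
    Γ.IsTropicalLinearSeries D r L := by
  rw [IsStronglyRecursive] at hL
  exact hL.1

/-- A set of `s + 1 ≤ r + 1` functions lies in a strongly recursive subseries of rank `s`. -/
theorem IsStronglyRecursive.exists_subseries (hL : Γ.IsStronglyRecursive D r L) (x : Γ.Point)
    {S : Finset (Γ.Point → ℝ)} (hSL : (S : Set (Γ.Point → ℝ)) ⊆ L) {s : ℕ}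
    (hcard : S.card = s + 1) (hs : s ≤ r) :
    ∃ L', (S : Set (Γ.Point → ℝ)) ⊆ L' ∧ L' ⊆ L ∧ Γ.IsStronglyRecursive D s L' := by
  classical
  induction r generalizing L with
  | zero =>
    obtain rfl : s = 0 := by omega
    exact ⟨L, hSL, subset_rfl, hL⟩
  | succ k ih =>
    rcases hs.eq_or_lt with rfl | hlt
    · exact ⟨L, hSL, subset_rfl, hL⟩
    have hinf : (L \ S).Infinite :=
      (hL.isTropicalLinearSeries.infinite x).sdiff S.finite_toSet
    -- The recursion takes exactly `k + 1` functions, and `S` has `s + 1`.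
    obtain ⟨T, hT, hTcard⟩ := hinf.exists_subset_card_eq (k - s)
    have hdisj : Disjoint S T := by
      rw [Finset.disjoint_right]
      exact fun f hf hfS => (hT hf).2 hfS
    have hL' := hL
    rw [IsStronglyRecursive] at hL'
    obtain ⟨L₁, hSL₁, hL₁, hrec⟩ := hL'.2.1 k rfl (S ∪ T)
      (by rw [Finset.coe_union]; exact Set.union_subset hSL fun f hf => (hT hf).1)
      (by rw [Finset.card_union_of_disjoint hdisj]; omega)
    rw [Finset.coe_union] at hSL₁
    obtain ⟨L₂, h1, h2, h3⟩ := ih hrec (Set.subset_union_left.trans hSL₁) (by omega)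
    exact ⟨L₂, h1, h2.trans hL₁, h3⟩

end Series

end MetricGraph

namespace MetricGraph

variable {V E : Type*} {Γ : MetricGraph V E}

/-! ### Positions of the functions in a series at a point -/

/-- The positions at `x` of the functions in `L`, relative to given slopes. -/
def positions {r : ℕ} (L : Set (Γ.Point → ℝ)) {x : Γ.Point} (s : Γ.Tangent x → Fin (r + 1) → ℤ) :
    Set (Γ.Tangent x → Fin (r + 1)) :=
  {j | ∃ f ∈ L, ∀ η, Γ.slope f x η = s η (j η)}

section Positions

variable [Fintype E] {D : Γ.Divisor} {r : ℕ} {L : Set (Γ.Point → ℝ)} {x : Γ.Point}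
  {s : Γ.Tangent x → Fin (r + 1) → ℤ}

/-- If the positions above `y` take `N + 1` values along `η`, then there is a subseries of rank `N`
all of whose functions have positions above `y`. -/
theorem IsStronglyRecursive.exists_subseries_above (hL : Γ.IsStronglyRecursive D r L)
    (hs : ∀ η, StrictMono (s η)) {y : Γ.Tangent x → Fin (r + 1)} {η : Γ.Tangent x} {N : ℕ}
    (hN : DotArray.rankAlong (DotArray.principal (positions L s) y) η = N) :
    ∃ L' ⊆ L, Γ.IsStronglyRecursive D N L' ∧ ∀ g ∈ L', ∀ ξ, s ξ (y ξ) ≤ Γ.slope g x ξ := by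
  let A : Set (Fin (r + 1)) :=
    (fun j : Γ.Tangent x → Fin (r + 1) => j η) '' DotArray.principal (positions L s) y
  have hA : A.Finite := Set.toFinite A
  have hAN : A.ncard = N + 1 := by
    have : (A.ncard : ℤ) - 1 = N := hN
    omega
  have hNr : N ≤ r := by
    have := Set.ncard_le_card A
    rw [Nat.card_eq_fintype_card, Fintype.card_fin] at this
    omega
  obtain ⟨S, hSL, hScard, hinj, -⟩ := Set.exists_finset_section (fun f => Γ.slope f x η)
    {f ∈ L | ∀ ξ, s ξ (y ξ) ≤ Γ.slope f x ξ} (hA.toFinset.map ⟨s η, (hs η).injective⟩) (by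
      intro m hm
      obtain ⟨i, hi, rfl⟩ := Finset.mem_map.1 (Finset.mem_coe.1 hm)
      obtain ⟨j, ⟨⟨f, hf, hfj⟩, hyj⟩, rfl⟩ := hA.mem_toFinset.1 hi
      refine ⟨f, ⟨hf, fun ξ => ?_⟩, hfj η⟩
      rw [hfj ξ]
      exact (hs ξ).monotone (hyj ξ))
  rw [Finset.card_map, ← Set.ncard_eq_toFinset_card A hA, hAN] at hScard
  obtain ⟨L', hSL', hL'L, hrec⟩ :=
    hL.exists_subseries x (fun f hf => (hSL hf).1) hScard hNr
  refine ⟨L', hL'L, hrec, fun g hg ξ => ?_⟩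
  obtain ⟨f, hf, hle⟩ := hrec.isTropicalLinearSeries.exists_slope_le hSL' hScard hinj hg ξ
  exact ((hSL hf).2 ξ).trans hle

/-- A series of rank N shows N + 1 slopes along `ξ`, and here all of them come from positions above
`y`. -/
theorem IsTropicalLinearSeries.le_rankAlong {N : ℕ} {L' : Set (Γ.Point → ℝ)}
    (hL' : Γ.IsTropicalLinearSeries D N L') (hs : ∀ η, StrictMono (s η)) (hL'L : L' ⊆ L)
    (hpos : ∀ f ∈ L, ∃ j : Γ.Tangent x → Fin (r + 1), ∀ η, Γ.slope f x η = s η (j η))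
    {y : Γ.Tangent x → Fin (r + 1)} (hy : ∀ g ∈ L', ∀ ξ, s ξ (y ξ) ≤ Γ.slope g x ξ)
    (ξ : Γ.Tangent x) :
    N ≤ DotArray.rankAlong (DotArray.principal (positions L s) y) ξ := by
  let A : Set (Fin (r + 1)) :=
    (fun j : Γ.Tangent x → Fin (r + 1) => j ξ) '' DotArray.principal (positions L s) y
  have hsub : Γ.slopeSet L' x ξ ⊆ s ξ '' A := by
    rintro _ ⟨f, hf, rfl⟩
    obtain ⟨j, hj⟩ := hpos f (hL'L hf)
    refine ⟨j ξ, ⟨j, ⟨⟨f, hL'L hf, hj⟩, fun ζ => ?_⟩, rfl⟩, (hj ξ).symm⟩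
    rw [← (hs ζ).le_iff_le, ← hj ζ]
    exact hy f hf ζ
  have h1 := Set.ncard_le_ncard hsub (Set.toFinite _)
  have h2 : (s ξ '' A).ncard ≤ A.ncard := Set.ncard_image_le (Set.toFinite A)
  rw [hL'.ncard_slopeSet] at h1
  have h3 : DotArray.rankAlong (DotArray.principal (positions L s) y) ξ = (A.ncard : ℤ) - 1 := rfl
  omega

theorem IsStronglyRecursive.totallyRankable_positions (hL : Γ.IsStronglyRecursive D r L)
    (hs : ∀ η, StrictMono (s η))
    (hpos : ∀ f ∈ L, ∃ j : Γ.Tangent x → Fin (r + 1), ∀ η, Γ.slope f x η = s η (j η)) :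
    DotArray.TotallyRankable (positions L s) := by
  intro y
  have key : ∀ η ξ, DotArray.rankAlong (DotArray.principal (positions L s) y) η ≤
      DotArray.rankAlong (DotArray.principal (positions L s) y) ξ := by
    intro η ξ
    by_cases h : 0 ≤ DotArray.rankAlong (DotArray.principal (positions L s) y) η
    · obtain ⟨N, hN⟩ := Int.eq_ofNat_of_zero_le h
      obtain ⟨L', hL'L, hrec, habove⟩ := hL.exists_subseries_above hs hN
      rw [hN]
      exact hrec.isTropicalLinearSeries.le_rankAlong hs hL'L hpos habove ξ
    -- Here the subarray has no values along `η`, and its rank −1 there is the least possible.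
    · unfold DotArray.rankAlong at h ⊢
      omega
  rcases isEmpty_or_nonempty (Γ.Tangent x) with he | ⟨⟨η⟩⟩
  · exact ⟨0, fun η => he.elim η⟩
  · exact ⟨_, fun ξ => (key ξ η).antisymm (key η ξ)⟩

theorem IsTropicalLinearSeries.hasRank_positions (hL : Γ.IsTropicalLinearSeries D r L)
    (hs : ∀ η, StrictMono (s η))
    (hpos : ∀ f ∈ L, ∃ j : Γ.Tangent x → Fin (r + 1), ∀ η, Γ.slope f x η = s η (j η)) :
    DotArray.HasRank (positions L s) r := by
  intro ξ
  refine le_antisymm ?_ ?_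
  · have := Set.ncard_le_card
      ((fun j : Γ.Tangent x → Fin (r + 1) => j ξ) '' positions L s)
    rw [Nat.card_eq_fintype_card, Fintype.card_fin] at this
    unfold DotArray.rankAlong
    omega
  · refine (hL.le_rankAlong hs subset_rfl hpos (y := 0) (fun g hg ζ => ?_) ξ).trans
      (DotArray.rankAlong_mono ?_ ξ)
    · obtain ⟨j, hj⟩ := hpos g hg
      rw [hj ζ]
      exact (hs ζ).monotone (Fin.zero_le _)
    · intro j hj
      exact hj.1

end Positions

/-! ### The slope structure of a strongly recursive series -/

theorem IsTropicalLinearSeries.exists_enumeration [Fintype E] {D : Γ.Divisor} {r : ℕ}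
    {L : Set (Γ.Point → ℝ)} (hL : Γ.IsTropicalLinearSeries D r L) (x : Γ.Point)
    (η : Γ.Tangent x) : ∃ s : Fin (r + 1) → ℤ, StrictMono s ∧ Set.range s = Γ.slopeSet L x η := by
  have hfin := hL.finite_slopeSet x η
  have hcard : hfin.toFinset.card = r + 1 := by
    rw [← Set.ncard_eq_toFinset_card _ hfin, hL.ncard_slopeSet]
  refine ⟨hfin.toFinset.orderEmbOfFin hcard, OrderEmbedding.strictMono _, ?_⟩
  rw [Finset.range_orderEmbOfFin, hfin.coe_toFinset]

/-- Finitely many piecewise linear functions are affine along all segments that avoid the interior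
of a suitable finite set. -/
theorem exists_verts [Fintype V] [Fintype E] {S : Finset (Γ.Point → ℝ)}
    (hPL : ∀ g ∈ S, Γ.IsPL g) :
    ∃ verts : Finset Γ.Point, (∀ v, .vertex v ∈ verts) ∧
      ∀ (e : E) (a b : ℝ), 0 ≤ a → a < b → b ≤ Γ.len e → (∀ t ∈ Set.Ioo a b, Γ.pt e t ∉ verts) →
        ∃ m : (Γ.Point → ℝ) → ℤ, ∀ g ∈ S, ∀ x η, Γ.PointsInto x η e a b →
          Γ.slope g x η = if η.1.2 then m g else -m g := by
  choose! F hF hFa using fun g hg => (hPL g hg).exists_breakpoints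
  let K : Set Γ.Point := Set.range Point.vertex ∪ ⋃ g ∈ S, ⋃ e, Γ.pt e '' F g e
  have hK : K.Finite := (Set.finite_range _).union
    (S.finite_toSet.biUnion fun g hg => Set.finite_iUnion fun e => (hF g hg e).image _)
  refine ⟨hK.toFinset, fun v => hK.mem_toFinset.2 (Or.inl ⟨v, rfl⟩),
    fun e a b ha hab hb havoid => ?_⟩
  have : ∀ g ∈ S, ∃ m, Γ.AffineOn g e a b m := by
    refine fun g hg => hFa g hg e a b ha hab hb fun t ht htF => ?_
    refine havoid t ht (hK.mem_toFinset.2 (Or.inr ?_))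
    simp only [Set.mem_iUnion]
    exact ⟨g, hg, e, t, htF, rfl⟩
  choose! m hm using this
  exact ⟨m, fun g hg x η hη => ((hm g hg).hasSlope hη).slope_eq⟩

theorem exists_segment_around {K : Finset Γ.Point} {e : E} {u : ℝ}
    {hu : u ∈ Set.Ioo 0 (Γ.len e)} (hK : .interior e u hu ∉ K) :
    ∃ a b, 0 ≤ a ∧ a < b ∧ b ≤ Γ.len e ∧ (∀ t ∈ Set.Ioo a b, Γ.pt e t ∉ K) ∧
      ∀ η : Γ.Tangent (.interior e u hu), Γ.PointsInto _ η e a b := by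
  obtain ⟨δ, hδ, hiso⟩ := (finite_setOf_pt_mem K.finite_toSet e).exists_pos_isolated u
  have ha : max (u - δ) 0 < u := max_lt (by linarith) hu.1
  have hb : u < min (u + δ) (Γ.len e) := lt_min (by linarith) hu.2
  refine ⟨_, _, le_max_right _ _, ha.trans hb, min_le_right _ _, fun t ht htK => ?_, fun η => ?_⟩
  · have h1 := (le_max_left _ _).trans_lt ht.1
    have h2 := (le_max_right _ _).trans_lt ht.1
    have h3 := ht.2.trans_le (min_le_left _ _)
    have h4 := ht.2.trans_le (min_le_right _ _)
    obtain rfl := hiso t ⟨⟨h2, h4⟩, htK⟩ (by rw [abs_lt]; constructor <;> linarith)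
    rw [pt_interior hu] at htK
    exact hK htK
  · rcases eq_interiorTangent η with rfl | rfl
    · exact ⟨rfl, Or.inl ⟨rfl, ha.le, hb⟩⟩
    · exact ⟨rfl, Or.inr ⟨rfl, ha, hb.le⟩⟩

/-- A tropical combination of functions that are affine near a point of valence two is concave
there. -/
theorem slope_add_slope_tropicalCombination_nonpos {S : Finset (Γ.Point → ℝ)}
    (hPL : ∀ g ∈ S, Γ.IsPL g) (hS : S.Nonempty) (a : (Γ.Point → ℝ) → ℝ) {x : Γ.Point}
    {η ξ : Γ.Tangent x} (h : ∀ g ∈ S, Γ.slope g x η = -Γ.slope g x ξ) :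
    Γ.slope (tropicalCombination S hS a) x η + Γ.slope (tropicalCombination S hS a) x ξ ≤ 0 := by
  obtain ⟨g₁, hg₁, -, hs₁, hle⟩ := exists_slope_tropicalCombination hPL hS a x η
  obtain ⟨g₂, hg₂, hact₂, hs₂, -⟩ := exists_slope_tropicalCombination hPL hS a x ξ
  have h1 := hle g₂ hg₂ hact₂
  have h2 := h g₂ hg₂
  omega

theorem IsStronglyRecursive.exists_slopeStructure [Fintype V] [Fintype E] {D : Γ.Divisor} {r : ℕ}
    {L : Set (Γ.Point → ℝ)} (hL : Γ.IsStronglyRecursive D r L) :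
    ∃ 𝔖 : Γ.SlopeStructure r, L ⊆ 𝔖.series D := by
  have hT := hL.isTropicalLinearSeries
  choose s hs hrange using hT.exists_enumeration
  obtain ⟨-, S, hS, hSL, hgen⟩ := hT.fg
  have hSPL : ∀ g ∈ S, Γ.IsPL g := fun g hg => hT.isPL (hSL hg)
  have hset := slopeSet_eq_image hS (fun f => hT.isPL) hSL hgen
  obtain ⟨verts, hverts, hseg⟩ := exists_verts hSPL
  have hpos : ∀ x, ∀ f ∈ L, ∃ j : Γ.Tangent x → Fin (r + 1), ∀ η,
      Γ.slope f x η = s x η (j η) := by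
    intro x f hf
    have : ∀ η, ∃ i, s x η i = Γ.slope f x η := fun η => by
      rw [← Set.mem_range, hrange]
      exact ⟨f, hf, rfl⟩
    choose j hj using this
    exact ⟨j, fun η => (hj η).symm⟩
  -- The generators determine the slope sets, and a strictly increasing enumeration is determined by
  -- its range; so opposite slopes need checking on generators only.
  have hopp : ∀ (x y : Γ.Point) (η : Γ.Tangent x) (ξ : Γ.Tangent y),
      (∀ g ∈ S, Γ.slope g x η = -Γ.slope g y ξ) → ∀ i, s x η i + s y ξ i.rev = 0 := by
    intro x y η ξ h i
    have hmono : StrictMono fun i : Fin (r + 1) => -s y ξ i.rev := fun i j hij =>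
      neg_lt_neg (hs y ξ (Fin.rev_lt_rev.2 hij))
    have : s x η = fun i => -s y ξ i.rev := by
      refine ((hs x η).range_inj hmono).1 ?_
      have h1 : Set.range (fun i : Fin (r + 1) => -s y ξ i.rev) =
          (fun z => -z) '' Set.range (s y ξ) := by
        rw [← Set.range_comp]
        exact Fin.rev_surjective.range_comp fun i => -s y ξ i
      rw [h1, hrange, hrange, hset, hset, Set.image_image]
      exact Set.image_congr h
    rw [this]
    simp
  have hpair : ∀ x ∉ verts, ∃ η ξ : Γ.Tangent x, η ≠ ξ ∧ (∀ ζ, ζ = η ∨ ζ = ξ) ∧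
      ∀ g ∈ S, Γ.slope g x η = -Γ.slope g x ξ := by
    rintro (v | ⟨e, u, hu⟩) hx
    · exact absurd (hverts v) hx
    refine ⟨Γ.interiorTangent e u hu true, Γ.interiorTangent e u hu false,
      interiorTangent_ne e u hu, eq_interiorTangent, fun g hg => ?_⟩
    obtain ⟨a, b, ha, hab, hb, havoid, hinto⟩ := exists_segment_around hx
    obtain ⟨m, hm⟩ := hseg e a b ha hab hb havoid
    rw [hm g hg _ _ (hinto _), hm g hg _ _ (hinto _)]
    simp [interiorTangent]
  have hP : ∀ x, ∃ P : Set (Γ.Tangent x → Fin (r + 1)), DotArray.IsPermutationArray P ∧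
      (x ∉ verts → P = DotArray.standard (Γ.Tangent x) r) ∧
      ∀ f ∈ L, ∃ j, (∀ η, Γ.slope f x η = s x η (j η)) ∧ j ∈ DotArray.redundantClosure P := by
    intro x
    by_cases hx : x ∈ verts
    · obtain ⟨P, hP, hsub⟩ := (hL.totallyRankable_positions (hs x)
        (hpos x)).exists_isPermutationArray (hT.hasRank_positions (hs x) (hpos x))
      refine ⟨P, hP, fun h => absurd hx h, fun f hf => ?_⟩
      obtain ⟨j, hj⟩ := hpos x f hf
      exact ⟨j, hj, hsub ⟨f, hf, hj⟩⟩
    · obtain ⟨η, ξ, hne, hall, hg⟩ := hpair x hx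
      refine ⟨_, DotArray.isPermutationArray_standard hne hall, fun _ => rfl, fun f hf => ?_⟩
      obtain ⟨j, hj⟩ := hpos x f hf
      refine ⟨j, hj, DotArray.mem_redundantClosure_standard hne hall ?_⟩
      obtain ⟨a, rfl⟩ := hgen f hf
      have hsum := slope_add_slope_tropicalCombination_nonpos hSPL hS a hg
      rw [hj, hj] at hsum
      -- Concavity bounds the slope along `η` by minus that along `ξ`; reversal of slopes turns this
      -- into a bound on indices.
      have := hopp x x η ξ hg (j ξ).rev
      rw [Fin.rev_rev] at this
      exact (hs x η).le_iff_le.1 (by omega)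
  choose P hPperm hPstd hPmem using hP
  refine ⟨{
    verts := verts
    mem_verts := fun x hx => ?_
    s := s
    s_strictMono := hs
    P := P
    isPermutationArray := hPperm
    segment_same := fun e a b ha hab hb havoid x y η ξ hη hξ hdir => ?_
    segment_opposite := fun e a b ha hab hb havoid x y η ξ hη hξ hdir => hopp x y η ξ fun g hg => ?_
    through := fun x hx η ξ hne => hopp x x η ξ fun g hg => ?_
    standard := hPstd }, fun f hf => ⟨hT.subset hf, fun x => hPmem x f hf⟩⟩
  · by_contra hxv
    obtain ⟨η, ξ, hne, hall, -⟩ := hpair x hxv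
    classical
    have : (Finset.univ : Finset (Γ.Tangent x)) = {η, ξ} := by ext ζ; simpa using hall ζ
    exact hx (by rw [valence, ← Finset.card_univ, this, Finset.card_pair hne])
  · refine ((hs x η).range_inj (hs y ξ)).1 ?_
    rw [hrange, hrange, hset, hset]
    obtain ⟨m, hm⟩ := hseg e a b ha hab hb havoid
    refine Set.image_congr fun g hg => ?_
    rw [hm g hg x η hη, hm g hg y ξ hξ, hdir]
  · obtain ⟨m, hm⟩ := hseg e a b ha hab hb havoid
    rw [hm g hg x η hη, hm g hg y ξ hξ]
    cases h1 : η.1.2 <;> cases h2 : ξ.1.2 <;> simp_all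
  · obtain ⟨η', ξ', -, hall, hopp'⟩ := hpair x hx
    have := hopp' g hg
    rcases hall η with rfl | rfl <;> rcases hall ξ with rfl | rfl
    · exact absurd rfl hne
    · exact this
    · omega
    · exact absurd rfl hne

/-! ### The local rank property implies the Baker-Norine rank property -/

theorem le_deg {B : Γ.Divisor} (hB : 0 ≤ B) (x : Γ.Point) : B x ≤ Γ.deg B := by
  by_cases hx : x ∈ B.support
  · exact Finset.single_le_sum (f := fun y => B y) (fun y _ => hB y) hx
  · rw [Finsupp.notMem_support_iff.1 hx]
    exact Finset.sum_nonneg fun y _ => hB y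

/-- All `r` chips are placed at `x`. -/
theorem IsTropicalLinearSeries.exists_le_ord [Fintype E] {D : Γ.Divisor} {r : ℕ}
    {L : Set (Γ.Point → ℝ)} (hL : Γ.IsTropicalLinearSeries D r L) (x : Γ.Point) :
    ∃ g ∈ L, (r : ℤ) ≤ Γ.ord g x + D x := by
  obtain ⟨g, hg, h⟩ := hL.rank (Finsupp.single x (r : ℤ)) (by simp) (by simp [deg])
  exact ⟨g, hg, by simpa using h x⟩

theorem IsStronglyRecursive.bakerNorineRankProperty [Fintype E] {D : Γ.Divisor} {r : ℕ}
    {L : Set (Γ.Point → ℝ)} (hL : Γ.IsStronglyRecursive D r L) {𝔖 : Γ.SlopeStructure r}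
    (h𝔖 : L ⊆ 𝔖.series D) {B : Γ.Divisor} (hB : 0 ≤ B) (hdeg : Γ.deg B ≤ r) {f : Γ.Point → ℝ}
    (hloc : 𝔖.LocalRankProperty f B) : Γ.BakerNorineRankProperty D f B := by
  intro x
  have hT := hL.isTropicalLinearSeries
  rcases isEmpty_or_nonempty (Γ.Tangent x) with he | hne
  -- At an isolated point every order is 0, so the rank condition gives `D x ≥ r`, which is at least
  -- the degree of `B`.
  · obtain ⟨g, -, hg⟩ := hT.exists_le_ord x
    have hBx := le_deg hB x
    simp only [ord, Finset.univ_eq_empty, Finset.sum_empty] at hg ⊢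
    omega
  obtain ⟨n, ⟨j, hj, hn⟩, hBn⟩ := hloc x
  have hs := 𝔖.s_strictMono x
  have hpos : ∀ g ∈ L, ∃ i : Γ.Tangent x → Fin (r + 1), ∀ η, Γ.slope g x η = 𝔖.s x η (i η) := by
    intro g hg
    obtain ⟨i, hi, -⟩ := (h𝔖 hg).2 x
    exact ⟨i, hi⟩
  have hMP : positions L (𝔖.s x) ⊆ DotArray.redundantClosure (𝔖.P x) := by
    rintro i ⟨g, hg, hi⟩
    obtain ⟨k, hk, hkP⟩ := (h𝔖 hg).2 x
    have : i = k := funext fun η => (hs η).injective (by rw [← hi η, hk η])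
    rwa [this]
  have hM := hL.totallyRankable_positions hs hpos
  obtain ⟨n', hn'⟩ := hM j
  have hP := 𝔖.isPermutationArray x
  have hle := DotArray.rank_le_of_subset_redundantClosure hM (hT.hasRank_positions hs hpos)
    hP.totallyRankable hP.hasRank hMP j hn hn'
  have hB0 : 0 ≤ B x := hB x
  obtain ⟨η⟩ := hne
  obtain ⟨N, rfl⟩ := Int.eq_ofNat_of_zero_le (show 0 ≤ n' by omega)
  obtain ⟨L', -, hrec, habove⟩ := hL.exists_subseries_above hs (hn' η)
  obtain ⟨g, hg, hord⟩ := hrec.isTropicalLinearSeries.exists_le_ord x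
  -- Each slope of `g` at `x` is at least that of `f`, so the order of `f` is at least that of `g`.
  have hslopes : ∑ η, Γ.slope f x η ≤ ∑ η, Γ.slope g x η :=
    Finset.sum_le_sum fun ξ _ => (hj ξ).trans_le (habove g hg ξ)
  unfold ord at hord ⊢
  omega

end MetricGraph

theorem mainTheorem5 {V E : Type*} [Fintype V] [Fintype E] (Γ : MetricGraph V E)
    (D : Γ.Divisor) (r : ℕ) (L : Set (Γ.Point → ℝ)) (hL : Γ.IsStronglyRecursive D r L) :
    (∃ 𝔖 : Γ.SlopeStructure r, L ⊆ 𝔖.series D) ∧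
    ∀ 𝔖 : Γ.SlopeStructure r, L ⊆ 𝔖.series D →
      ∀ B : Γ.Divisor, 0 ≤ B → Γ.deg B ≤ r →
        ∀ f ∈ L, 𝔖.LocalRankProperty f B → Γ.BakerNorineRankProperty D f B :=
  ⟨hL.exists_slopeStructure,
    fun _ h𝔖 _ hB hdeg _ _ hloc => hL.bakerNorineRankProperty h𝔖 hB hdeg hloc⟩
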